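/- **Setting.** Let $T\in\mathbb N$, $0<\alpha\le 1$, and let $E_1,\dots,E_T\ge 0$ and $\bar E_1,\dots,\bar E_T\ge 0$ be the energies harvested by users 1 and 2 in $T$ unit-length slots. Let $\mathcal F$ be the set of triples $(\delta,P,\bar P)$ of vectors in $[0,\infty)^T$ with, for all $k=1,\dots,T$, $$\sum_{i\le k}P_i\le\sum_{i\le k}(E_i-\delta_i),\qquad \sum_{i\le k}\bar P_i\le\sum_{i\le k}(\bar E_i+\alpha\delta_i),\qquad \sum_{i\le k}\delta_i\le\sum_{i\le k}E_i .$$ Put $R_1(P)=\sum_{i=1}^T\frac12\log(1+P_i)$ and $R_2(\bar P)=\sum_{i=1}^T\frac12\log(1+\bar P_i)$. The capacity region of the Gaussian two-way channel with one-way energy transfer is $$\mathcal C=\bigcup_{(\delta,P,\bar P)\in\mathcal F}\{(r_1,r_2): 0\le r_1\le R_1(P),\ 0\le r_2\le R_2(\bar P)\}.$$ **Algorithm (two-dimensional directional water-filling with metered taps), for weights $\theta_1,\theta_2>0$.** For each user and each slot there is a vessel. Initially the vessel of user 1 in slot $i$ holds the amount $E_i$ of water and that of user 2 holds $\bar E_i/\alpha$.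 A vessel of user 1 holding the amount $w$ has water level $(w+1)/\theta_1$, a vessel of user 2 has level $(w+1/\alpha)/\theta_2$. For each user a right tap leads from each slot to the next slot, and in each slot a down tap leads from user 1 to user 2. Each tap has a meter showing the net amount that has passed through it; initially all meters read $0$ and all taps are closed. When some taps are open, an admissible flow conducts an amount $w>0$ of the water contained in a vessel $a$ to a vessel $b\ne a$ along a chain of open taps, each passed either forward, or backward if its meter reads at least $w$ when it is passed (the reading then decreases by $w$), such that afterwards the level of $a$ is at least that of $b$. The levels are balanced if no admissible flow exists. The algorithm first opens all right taps and lets water flow (finitely many admissible flows) until the levels are balanced. Then it opens the down taps one by one, in the order of slots $T,T-1,\dots,1$, letting water flow until the levels are balanced after each opening. Its output is the policy in which $\delta_i$ is the final reading of the $i$-th down meter, $P_i$ is the final amount of water in user 1's vessel in slot $i$, and $\bar P_i$ is $\alpha$ times the final amount in user 2's vessel in slot $i$. **Claim.** 1. For all $\theta_1,\theta_2>0$ the algorithm has an output, and every output $(\delta,P,\bar P)$ lies in $\mathcal F$ and solves $$\max_{(\delta,P,\bar P)\in\mathcal F}\ \sum_{i=1}^T\Big(\theta_1\tfrac12\log(1+P_i)+\theta_2\tfrac12\log(1+\bar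 P_i)\Big),$$ and its rate pair $(R_1(P),R_2(\bar P))$ lies on the topological boundary of $\mathcal C$. 2. The algorithm traces the boundary of the capacity region: the set of rate pairs $(R_1(P),R_2(\bar P))$ of its outputs, over all $\theta_1,\theta_2>0$, is exactly the set of points of $\mathcal C$ that are maximal in the componentwise order. -/

import Mathlib

/-! Gaussian two-way channel with energy harvesting users and one-way energy transfer from
user 1 to user 2 with efficiency `α`, over `T` unit-length slots; `E` and `E'` are the energy
arrivals of users 1 and 2. -/

namespace TwoWay

/-- A transfer and power policy: energy transfers `δ`, powers `P` of user 1, powers `P'` of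
user 2. -/
@[ext]
structure Policy (T : ℕ) where
  δ : Fin T → ℝ
  P : Fin T → ℝ
  P' : Fin T → ℝ

/-- The feasible set: powers and transfers are nonnegative amounts of energy and obey energy
causality at the end of every slot. -/
def feasible {T : ℕ} (α : ℝ) (E E' : Fin T → ℝ) : Set (Policy T) :=
  {x | (∀ i, 0 ≤ x.δ i) ∧ (∀ i, 0 ≤ x.P i) ∧ (∀ i, 0 ≤ x.P' i) ∧
    (∀ k, ∑ i ∈ Finset.Iic k, x.P i ≤ ∑ i ∈ Finset.Iic k, (E i - x.δ i)) ∧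
    (∀ k, ∑ i ∈ Finset.Iic k, x.P' i ≤ ∑ i ∈ Finset.Iic k, (E' i + α * x.δ i)) ∧
    (∀ k, ∑ i ∈ Finset.Iic k, x.δ i ≤ ∑ i ∈ Finset.Iic k, E i)}

/-- The throughput of a user with the given powers. -/
noncomputable def throughput {T : ℕ} (p : Fin T → ℝ) : ℝ :=
  ∑ i, 1 / 2 * Real.log (1 + p i)

/-- The pair of throughputs of the two users. -/
noncomputable def rates {T : ℕ} (x : Policy T) : ℝ × ℝ :=
  (throughput x.P, throughput x.P')

/-- The objective of the weighted-throughput problem. -/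
noncomputable def weightedThroughput {T : ℕ} (θ₁ θ₂ : ℝ) (x : Policy T) : ℝ :=
  ∑ i, (θ₁ * (1 / 2 * Real.log (1 + x.P i)) + θ₂ * (1 / 2 * Real.log (1 + x.P' i)))

/-- The rate pairs achievable with a given policy. -/
def achievable {T : ℕ} (x : Policy T) : Set (ℝ × ℝ) :=
  {R | 0 ≤ R.1 ∧ 0 ≤ R.2 ∧ R.1 ≤ throughput x.P ∧ R.2 ≤ throughput x.P'}

/-- The capacity region. -/
def capacityRegion {T : ℕ} (α : ℝ) (E E' : Fin T → ℝ) : Set (ℝ × ℝ) :=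
  ⋃ x ∈ feasible α E E', achievable x

/-! ### Two-dimensional directional water-filling -/

/-- The vessel of user 1 (row `0`, above) or user 2 (row `1`, below) in a slot. -/
abbrev Vessel (T : ℕ) := Fin 2 × Fin T

/-- The water meters: `m a b` is the net amount of water that has passed from vessel `a` to
vessel `b` through the tap joining them. -/
abbrev Meters (T : ℕ) := Vessel T → Vessel T → ℝ

/-- There is a right permeable tap from each slot of a user to the next slot of that user. -/
def IsRightTap {T : ℕ} (a b : Vessel T) : Prop :=
  a.1 = b.1 ∧ (a.2 : ℕ) + 1 = b.2

/-- There is a down permeable tap from user 1 to user 2 in each slot. -/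
def IsDownTap {T : ℕ} (a b : Vessel T) : Prop :=
  a.1 = 0 ∧ b.1 = 1 ∧ a.2 = b.2

/-- The taps that are open when all right taps and the down taps of the last `n` slots have been
opened. -/
def OpenTap {T : ℕ} (n : ℕ) (a b : Vessel T) : Prop :=
  IsRightTap a b ∨ (IsDownTap a b ∧ T ≤ (a.2 : ℕ) + n)

/-- The water filled in with all taps closed; the energy of user 2 is scaled by `1 / α`. -/
noncomputable def initialWater {T : ℕ} (α : ℝ) (E E' : Fin T → ℝ) (v : Vessel T) : ℝ :=
  if v.1 = 0 then E v.2 else E' v.2 / α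

/-- The water in a vessel, when it was filled with `fill` and the meters read `m`. -/
def water {T : ℕ} (fill : Vessel T → ℝ) (m : Meters T) (v : Vessel T) : ℝ :=
  fill v + ∑ u, m u v - ∑ u, m v u

/-- The water level of a vessel that holds the amount `w`: before division by the weights, the base
levels of users 1 and 2 are `1` and `1 / α`. -/
noncomputable def level {T : ℕ} (α θ₁ θ₂ : ℝ) (v : Vessel T) (w : ℝ) : ℝ :=
  if v.1 = 0 then (w + 1) / θ₁ else (w + 1 / α) / θ₂

/-- Add `w` to the reading of the meter between `a` and `b`. -/
def bump {T : ℕ} (m : Meters T) (a b : Vessel T) (w : ℝ) : Meters T :=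
  fun u v => m u v + if u = a ∧ v = b then w else 0

/-- `Pour tap w m a b m'`: the amount `w` is conducted from vessel `a` to vessel `b` along a chain
of open taps, and this changes the meters from `m` to `m'`. A tap is passed forward without
restriction, and backward only as far as its meter shows that water has already passed it. -/
inductive Pour {T : ℕ} (tap : Vessel T → Vessel T → Prop) (w : ℝ) :
    Meters T → Vessel T → Vessel T → Meters T → Prop
  | stop_here (m : Meters T) (a : Vessel T) : Pour tap w m a a m
  | forward {m m' : Meters T} {a b c : Vessel T} (h : tap a b)
      (rest : Pour tap w (bump m a b w) b c m') : Pour tap w m a c m'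
  | backward {m m' : Meters T} {a b c : Vessel T} (h : tap b a) (hw : w ≤ m b a)
      (rest : Pour tap w (bump m b a (-w)) b c m') : Pour tap w m a c m'

/-- A flow of water: a positive amount of the water in a vessel `a` moves to another vessel `b`,
and afterwards the level of `a` is still at least that of `b` (so that it was higher before). -/
def Flow {T : ℕ} (α θ₁ θ₂ : ℝ) (fill : Vessel T → ℝ) (tap : Vessel T → Vessel T → Prop)
    (m m' : Meters T) : Prop :=
  ∃ (a b : Vessel T) (w : ℝ), a ≠ b ∧ 0 < w ∧ w ≤ water fill m a ∧ Pour tap w m a b m' ∧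
    level α θ₁ θ₂ b (water fill m' b) ≤ level α θ₁ θ₂ a (water fill m' a)

/-- The water levels are balanced: no water can flow any more. -/
def Balanced {T : ℕ} (α θ₁ θ₂ : ℝ) (fill : Vessel T → ℝ) (tap : Vessel T → Vessel T → Prop)
    (m : Meters T) : Prop :=
  ∀ m', ¬ Flow α θ₁ θ₂ fill tap m m'

/-- With the given taps open, water flows until the levels are balanced. -/
def Settles {T : ℕ} (α θ₁ θ₂ : ℝ) (fill : Vessel T → ℝ) (tap : Vessel T → Vessel T → Prop)
    (m m' : Meters T) : Prop :=
  Relation.ReflTransGen (Flow α θ₁ θ₂ fill tap) m m' ∧ Balanced α θ₁ θ₂ fill tap m'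

/-- `Reads α θ₁ θ₂ fill n m`: the meters may read `m` at the end of the `n`-th step of the
algorithm. Initially all meters read zero. In step `0` the right taps are opened, which is
directional water-filling for each user separately. In each further step one more down tap is
opened, from the last slot backward. After each opening the water settles. -/
inductive Reads {T : ℕ} (α θ₁ θ₂ : ℝ) (fill : Vessel T → ℝ) : ℕ → Meters T → Prop
  | right {m : Meters T} (h : Settles α θ₁ θ₂ fill (OpenTap 0) 0 m) : Reads α θ₁ θ₂ fill 0 m
  | down {n : ℕ} {m m' : Meters T} (prev : Reads α θ₁ θ₂ fill n m)
      (h : Settles α θ₁ θ₂ fill (OpenTap (n + 1)) m m') : Reads α θ₁ θ₂ fill (n + 1) m'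

/-- The policy read off the meters: the transfers are the readings of the down meters, the powers
are the amounts of water, scaled back by `α` for user 2. -/
def policyOf {T : ℕ} (α : ℝ) (fill : Vessel T → ℝ) (m : Meters T) : Policy T where
  δ i := m (0, i) (1, i)
  P i := water fill m (0, i)
  P' i := α * water fill m (1, i)

/-- The policy `x` is an output of the algorithm: it is read off the meters after all `T` down taps
have been opened. -/
def IsOutput {T : ℕ} (α θ₁ θ₂ : ℝ) (E E' : Fin T → ℝ) (x : Policy T) : Prop :=
  ∃ m, Reads α θ₁ θ₂ (initialWater α E E') T m ∧ x = policyOf α (initialWater α E E') m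

end TwoWay

namespace TwoWay

open Relation Finset

variable {T : ℕ} {α θ₁ θ₂ : ℝ} {fill : Vessel T → ℝ} {tap : Vessel T → Vessel T → Prop}
  {E E' : Fin T → ℝ}

/-! Measuring user 2's energy in units of `1 / α` makes the down taps lossless, so policies become
flows in a network of vessels. Admissible meters yield feasible policies
(`Admissible.policyOf_mem_feasible`), and each feasible policy is dominated by that of some
admissible meters (`metersOf`). The objective is then a separable concave utility whose marginal
value in a vessel is the inverse of its level.

Optimality is network duality. A flow strictly raises the utility, so optimal meters are balanced.
Conversely, in balanced water the inverse of the lowest level reachable through residual taps is a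
dual price (`Balanced.exists_isPrice`), which certifies optimality (`IsPrice.isOptimal`). Only the
final balance with all taps open matters, not the order of opening.

Termination is needed only for some sequence of flows. An optimum `t` exists by compactness; while
the water differs from that of `t`, one can pour toward `t` so that one more meter or vessel agrees
with it and none that agreed is disturbed (`exists_flow_discrepancy_lt`).

For positive weights an optimum gives a maximal boundary point. Conversely, a maximal point is
supported by nonnegative weights (`exists_weights`). If both are positive, strict concavity makes
the powers unique, so the output attains the point. If one vanishes, a sufficiently lopsided pair of
positive weights already attains that end point. -/

/-- Nonnegative meter readings that vanish off the taps and leave nonnegative amounts of water. -/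
structure Admissible (fill : Vessel T → ℝ) (tap : Vessel T → Vessel T → Prop) (m : Meters T) :
    Prop where
  nonneg : ∀ a b, 0 ≤ m a b
  off : ∀ a b, ¬ tap a b → m a b = 0
  water_nonneg : ∀ v, 0 ≤ water fill m v

/-- The utility of an amount of water in a vessel; its derivative is the inverse of the level. -/
noncomputable def util (α θ₁ θ₂ : ℝ) (v : Vessel T) (w : ℝ) : ℝ :=
  if v.1 = 0 then θ₁ * Real.log (1 + w) else θ₂ * Real.log (1 + α * w)

/-- The total utility of the water in all vessels. -/
noncomputable def totalUtil (α θ₁ θ₂ : ℝ) (fill : Vessel T → ℝ) (m : Meters T) : ℝ :=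
  ∑ v, util α θ₁ θ₂ v (water fill m v)

/-- Admissible meters of maximal total utility. -/
def IsOptimal (α θ₁ θ₂ : ℝ) (fill : Vessel T → ℝ) (tap : Vessel T → Vessel T → Prop)
    (m : Meters T) : Prop :=
  Admissible fill tap m ∧
    ∀ m', Admissible fill tap m' → totalUtil α θ₁ θ₂ fill m' ≤ totalUtil α θ₁ θ₂ fill m

/-! ### Levels and tangent bounds for the utility -/

theorem level_pos (hα : 0 < α) (h₁ : 0 < θ₁) (h₂ : 0 < θ₂) (v : Vessel T) {w : ℝ} (hw : 0 ≤ w) :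
    0 < level α θ₁ θ₂ v w := by
  unfold level; split_ifs <;> positivity

theorem level_mono (h₁ : 0 < θ₁) (h₂ : 0 < θ₂) (v : Vessel T) {w w' : ℝ} (hw : w ≤ w') :
    level α θ₁ θ₂ v w ≤ level α θ₁ θ₂ v w' := by
  unfold level; split_ifs <;> gcongr

theorem continuous_level (v : Vessel T) : Continuous (level α θ₁ θ₂ v) := by
  unfold level; split_ifs <;> fun_prop

theorem mul_log_sub_le {θ x y : ℝ} (hθ : 0 < θ) (hx : 0 < x) (hy : 0 < y) :
    θ * Real.log y - θ * Real.log x ≤ (y - x) * (θ / x) := by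
  have h := Real.log_le_sub_one_of_pos (div_pos hy hx)
  rw [Real.log_div hy.ne' hx.ne'] at h
  calc _ = θ * (Real.log y - Real.log x) := by ring
    _ ≤ θ * (y / x - 1) := by gcongr
    _ = _ := by field_simp

theorem mul_log_sub_lt {θ x y : ℝ} (hθ : 0 < θ) (hx : 0 < x) (hy : 0 < y) (hxy : y ≠ x) :
    θ * Real.log y - θ * Real.log x < (y - x) * (θ / x) := by
  have h := Real.log_lt_sub_one_of_pos (div_pos hy hx) (by rwa [Ne, div_eq_one_iff_eq hx.ne'])
  rw [Real.log_div hy.ne' hx.ne'] at h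
  calc _ = θ * (Real.log y - Real.log x) := by ring
    _ < θ * (y / x - 1) := by gcongr
    _ = _ := by field_simp

/-- Concavity: the utility lies below its tangent. For user 2 the slope `α θ₂ / (1 + α w)` equals
`θ₂ / (w + 1 / α)`, which explains the base level `1 / α`. -/
theorem util_sub_le (hα : 0 < α) (h₁ : 0 < θ₁) (h₂ : 0 < θ₂) (v : Vessel T) {w w' : ℝ}
    (hw : 0 ≤ w) (hw' : 0 ≤ w') :
    util α θ₁ θ₂ v w' - util α θ₁ θ₂ v w ≤ (w' - w) * (1 / level α θ₁ θ₂ v w) := by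
  unfold util level
  split_ifs
  · refine (mul_log_sub_le h₁ (by positivity) (by positivity)).trans_eq ?_
    field_simp; ring
  · refine (mul_log_sub_le h₂ (by positivity) (by positivity)).trans_eq ?_
    field_simp; ring

theorem util_sub_lt (hα : 0 < α) (h₁ : 0 < θ₁) (h₂ : 0 < θ₂) (v : Vessel T) {w w' : ℝ}
    (hw : 0 ≤ w) (hw' : 0 ≤ w') (hne : w' ≠ w) :
    util α θ₁ θ₂ v w' - util α θ₁ θ₂ v w < (w' - w) * (1 / level α θ₁ θ₂ v w) := by
  unfold util level
  split_ifs
  · refine (mul_log_sub_lt h₁ (by positivity) (by positivity) (by simpa using hne)).trans_eq ?_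
    field_simp; ring
  · refine (mul_log_sub_lt h₂ (by positivity) (by positivity)
      (by simpa [hα.ne'] using hne)).trans_eq ?_
    field_simp; ring

/-! ### Bookkeeping of the water -/

/-- Summation by parts. It serves with `q` constant (conservation), a potential (bounded readings),
dual prices (optimality) and the indicator of a cut (`exists_toward_lt`). -/
theorem sum_mul_water (fill q : Vessel T → ℝ) (m : Meters T) :
    ∑ v, q v * water fill m v = ∑ v, q v * fill v + ∑ u, ∑ v, m u v * (q v - q u) := by
  have h1 : ∑ u, ∑ v, m u v * (q v - q u) =
      ∑ u, ∑ v, q v * m u v - ∑ u, ∑ v, q u * m u v := by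
    simp only [← sum_sub_distrib]
    exact sum_congr rfl fun u _ => sum_congr rfl fun v _ => by ring
  rw [h1, sum_comm (f := fun u v => q v * m u v), ← add_sub_assoc, ← sum_add_distrib,
    ← sum_sub_distrib]
  refine sum_congr rfl fun v _ => ?_
  rw [← mul_sum, ← mul_sum, water]
  ring

theorem sum_water (fill : Vessel T → ℝ) (m : Meters T) : ∑ v, water fill m v = ∑ v, fill v := by
  simpa using sum_mul_water fill (fun _ => 1) m

theorem Admissible.water_le {m : Meters T} (h : Admissible fill tap m) (v : Vessel T) :
    water fill m v ≤ ∑ u, fill u := by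
  rw [← sum_water fill m]
  exact single_le_sum (fun u _ => h.water_nonneg u) (mem_univ v)

theorem Admissible.mono {tap' : Vessel T → Vessel T → Prop} {m : Meters T}
    (h : Admissible fill tap m) (htap : ∀ a b, tap a b → tap' a b) : Admissible fill tap' m :=
  ⟨h.nonneg, fun a b hab => h.off a b fun h' => hab (htap a b h'), h.water_nonneg⟩

theorem Admissible.tap_of_pos {m : Meters T} (h : Admissible fill tap m) {a b : Vessel T}
    (hab : 0 < m a b) : tap a b := by
  by_contra hn
  exact hab.ne' (h.off a b hn)

theorem water_bump (m : Meters T) (a b v : Vessel T) (w : ℝ) :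
    water fill (bump m a b w) v =
      water fill m v + (if v = b then w else 0) - (if v = a then w else 0) := by
  have h1 : ∑ u, (if u = a ∧ v = b then w else 0) = if v = b then w else 0 := by
    by_cases h : v = b <;> simp [h]
  have h2 : ∑ u, (if v = a ∧ u = b then w else 0) = if v = a then w else 0 := by
    by_cases h : v = a <;> simp [h]
  simp only [water, bump, sum_add_distrib, h1, h2]
  ring

theorem Pour.water_eq {w : ℝ} {m m' : Meters T} {a b : Vessel T} (h : Pour tap w m a b m')
    (v : Vessel T) :
    water fill m' v = water fill m v + (if v = b then w else 0) - (if v = a then w else 0) := by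
  induction h with
  | stop_here => ring
  | forward _ _ ih => rw [ih, water_bump]; ring
  | backward _ _ _ ih => rw [ih, water_bump]; split_ifs <;> ring

theorem Pour.nonneg {w : ℝ} (hw : 0 ≤ w) {m m' : Meters T} {a b : Vessel T}
    (h : Pour tap w m a b m') (hm : ∀ u v, 0 ≤ m u v) (u v : Vessel T) : 0 ≤ m' u v := by
  induction h with
  | stop_here => exact hm u v
  | forward _ _ ih =>
    refine ih fun u v => ?_
    have := hm u v
    unfold bump; split_ifs <;> linarith
  | backward _ hwm _ ih =>
    refine ih fun u v => ?_
    have := hm u v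
    unfold bump
    split_ifs with h
    · obtain ⟨rfl, rfl⟩ := h; linarith
    · linarith

theorem Pour.off {w : ℝ} {m m' : Meters T} {a b : Vessel T}
    (h : Pour tap w m a b m') (hm : ∀ u v, ¬ tap u v → m u v = 0) (u v : Vessel T)
    (huv : ¬ tap u v) : m' u v = 0 := by
  induction h with
  | stop_here => exact hm u v huv
  | forward ht _ ih =>
    refine ih fun u v huv => ?_
    rw [bump, hm u v huv, if_neg, add_zero]
    rintro ⟨rfl, rfl⟩; exact huv ht
  | backward ht _ _ ih =>
    refine ih fun u v huv => ?_
    rw [bump, hm u v huv, if_neg, add_zero]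
    rintro ⟨rfl, rfl⟩; exact huv ht

theorem Flow.admissible {m m' : Meters T} (h : Flow α θ₁ θ₂ fill tap m m')
    (hm : Admissible fill tap m) : Admissible fill tap m' := by
  obtain ⟨a, b, w, hab, hw, hwa, hp, -⟩ := h
  refine ⟨hp.nonneg hw.le hm.nonneg, hp.off hm.off, fun v => ?_⟩
  have := hm.water_nonneg v
  rw [hp.water_eq]
  split_ifs <;> subst_vars <;> linarith

/-- Tangents are taken at the final amounts, where the level of `a` is still at least that of `b`:
the loss at `a` is less than `w / level a`, the gain at `b` at least `w / level b`. -/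
theorem Flow.totalUtil_lt (hα : 0 < α) (h₁ : 0 < θ₁) (h₂ : 0 < θ₂) {m m' : Meters T}
    (h : Flow α θ₁ θ₂ fill tap m m') (hm : Admissible fill tap m) :
    totalUtil α θ₁ θ₂ fill m < totalUtil α θ₁ θ₂ fill m' := by
  have hm' := h.admissible hm
  obtain ⟨a, b, w, hab, hw, hwa, hp, hl⟩ := h
  have ha := hp.water_eq (fill := fill) a
  have hb := hp.water_eq (fill := fill) b
  simp only [hab, hab.symm, if_true, if_false] at ha hb
  have e1 := util_sub_lt hα h₁ h₂ a (hm'.water_nonneg a) (hm.water_nonneg a) (by linarith)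
  have e2 := util_sub_le hα h₁ h₂ b (hm'.water_nonneg b) (hm.water_nonneg b)
  have e3 : 1 / level α θ₁ θ₂ a (water fill m' a) ≤ 1 / level α θ₁ θ₂ b (water fill m' b) :=
    one_div_le_one_div_of_le (level_pos hα h₁ h₂ b (hm'.water_nonneg b)) hl
  have e4 : ∑ v, (util α θ₁ θ₂ v (water fill m' v) - util α θ₁ θ₂ v (water fill m v)) =
      ∑ v ∈ {a, b}, (util α θ₁ θ₂ v (water fill m' v) - util α θ₁ θ₂ v (water fill m v)) := by
    refine (sum_subset (subset_univ _) fun v _ hv => ?_).symm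
    simp only [mem_insert, mem_singleton, not_or] at hv
    rw [hp.water_eq (fill := fill) v, if_neg hv.1, if_neg hv.2, add_zero, sub_zero, sub_self]
  rw [sum_pair hab, sum_sub_distrib] at e4
  unfold totalUtil
  have e5 : water fill m a - water fill m' a = w := by linarith
  have e6 : water fill m b - water fill m' b = -w := by linarith
  rw [e5] at e1
  rw [e6] at e2
  nlinarith

theorem IsOptimal.balanced (hα : 0 < α) (h₁ : 0 < θ₁) (h₂ : 0 < θ₂) {m : Meters T}
    (h : IsOptimal α θ₁ θ₂ fill tap m) : Balanced α θ₁ θ₂ fill tap m := fun m' hf =>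
  (hf.totalUtil_lt hα h₁ h₂ h.1).not_ge (h.2 m' (hf.admissible h.1))

/-! ### Existence of optimal meters -/

theorem continuous_water (v : Vessel T) : Continuous fun m => water fill m v := by
  unfold water; fun_prop

/-- Row plus slot is a potential that rises by one along each tap, so the sum of all readings is the
total rise in potential of a fixed amount of water. -/
theorem Admissible.le_bound (hfill : ∀ v, 0 ≤ fill v)
    (htap : ∀ a b : Vessel T, tap a b → (b.1 : ℕ) + b.2 = a.1 + a.2 + 1) {m : Meters T}
    (h : Admissible fill tap m) (a b : Vessel T) : m a b ≤ (T + 2) * ∑ v, fill v := by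
  have key := sum_mul_water fill (fun v => ((v.1 : ℕ) : ℝ) + ((v.2 : ℕ) : ℝ)) m
  have e1 : ∑ u, ∑ v, m u v * ((((v.1 : ℕ) : ℝ) + ((v.2 : ℕ) : ℝ)) -
      (((u.1 : ℕ) : ℝ) + ((u.2 : ℕ) : ℝ))) = ∑ u, ∑ v, m u v := by
    refine sum_congr rfl fun u _ => sum_congr rfl fun v _ => ?_
    by_cases ht : tap u v
    · have : (((v.1 : ℕ) : ℝ) + ((v.2 : ℕ) : ℝ)) = ((u.1 : ℕ) : ℝ) + ((u.2 : ℕ) : ℝ) + 1 :=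
        mod_cast htap u v ht
      rw [this]; ring
    · simp [h.off u v ht]
  have e2 : m a b ≤ ∑ u, ∑ v, m u v :=
    (single_le_sum (fun v _ => h.nonneg a v) (mem_univ b)).trans
      (single_le_sum (f := fun u => ∑ v, m u v) (fun u _ => sum_nonneg fun v _ => h.nonneg u v)
        (mem_univ a))
  have e3 : 0 ≤ ∑ v : Vessel T, (((v.1 : ℕ) : ℝ) + ((v.2 : ℕ) : ℝ)) * fill v :=
    sum_nonneg fun v _ => mul_nonneg (by positivity) (hfill v)
  rw [e1] at key
  have e4 : ∑ v : Vessel T, (((v.1 : ℕ) : ℝ) + ((v.2 : ℕ) : ℝ)) * water fill m v ≤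
      ∑ v, ((T : ℝ) + 2) * water fill m v := by
    refine sum_le_sum fun v _ => mul_le_mul_of_nonneg_right ?_ (h.water_nonneg v)
    have : (v.1 : ℕ) + v.2 ≤ T + 2 := by omega
    exact_mod_cast this
  rw [← mul_sum, sum_water] at e4
  linarith

theorem exists_isOptimal (hα : 0 < α) (hfill : ∀ v, 0 ≤ fill v)
    (htap : ∀ a b : Vessel T, tap a b → (b.1 : ℕ) + b.2 = a.1 + a.2 + 1) :
    ∃ m, IsOptimal α θ₁ θ₂ fill tap m := by
  classical
  -- The upper corner of the box vanishes off the taps, so the box also encodes the condition `off`.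
  let bd : Meters T := fun a b => if tap a b then (T + 2) * ∑ v, fill v else 0
  let K : Set (Meters T) := Set.Icc 0 bd ∩ {m | ∀ v, 0 ≤ water fill m v}
  have hK : ∀ m, m ∈ K ↔ Admissible fill tap m := by
    refine fun m => ⟨fun h => ⟨h.1.1, fun a b hab => ?_, h.2⟩,
      fun h => ⟨⟨h.nonneg, fun a b => ?_⟩, h.water_nonneg⟩⟩
    · have h1 := h.1.2 a b
      simp only [bd, if_neg hab] at h1
      exact le_antisymm h1 (h.1.1 a b)
    · simp only [bd]
      split_ifs with hab
      · exact h.le_bound hfill htap a b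
      · exact (h.off a b hab).le
  have hc : IsCompact K := by
    refine isCompact_Icc.inter_right ?_
    simp only [Set.ofPred_forall]
    exact isClosed_iInter fun v => isClosed_le continuous_const (continuous_water v)
  have hne : K.Nonempty := ⟨0, (hK 0).2 ⟨fun _ _ => le_rfl, fun _ _ _ => rfl, fun v => by
    simpa [water] using hfill v⟩⟩
  have hcont : ContinuousOn (totalUtil α θ₁ θ₂ fill) K := by
    unfold totalUtil
    refine continuousOn_finsetSum _ fun v _ => ?_
    unfold util
    have hw : ∀ m ∈ K, 0 ≤ water fill m v := fun m hm => hm.2 v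
    split_ifs
    · refine continuousOn_const.mul (ContinuousOn.log (by
        have := continuous_water (fill := fill) v; fun_prop) fun m hm => ?_)
      have := hw m hm
      positivity
    · refine continuousOn_const.mul (ContinuousOn.log (by
        have := continuous_water (fill := fill) v; fun_prop) fun m hm => ?_)
      have := hw m hm
      positivity
  obtain ⟨m, hm, hmax⟩ := hc.exists_isMaxOn hne hcont
  exact ⟨m, (hK m).1 hm, fun m' hm' => hmax ((hK m').2 hm')⟩

/-! ### Water levels and prices -/

/-- Some water can be conducted directly from `a` to `b`. -/
def Residual (tap : Vessel T → Vessel T → Prop) (m : Meters T) (a b : Vessel T) : Prop :=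
  tap a b ∨ (tap b a ∧ 0 < m b a)

/-- Every sufficiently small amount can be poured along a residual chain. -/
theorem exists_pour_of_residual {m : Meters T} {a b : Vessel T}
    (h : ReflTransGen (Residual tap m) a b) :
    ∃ η > 0, ∀ w, 0 < w → w < η → ∀ m₁ : Meters T, (∀ u v, m u v - η ≤ m₁ u v) →
      ∃ m', Pour tap w m₁ a b m' := by
  induction h using ReflTransGen.head_induction_on with
  | refl => exact ⟨1, one_pos, fun w _ _ m₁ _ => ⟨m₁, .stop_here _ _⟩⟩
  | @head a c hac _ ih =>
    obtain ⟨η, hη, ih⟩ := ih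
    rcases hac with ht | ⟨ht, hpos⟩
    · refine ⟨η, hη, fun w hw hwη m₁ hm₁ => ?_⟩
      obtain ⟨m', hm'⟩ := ih w hw hwη (bump m₁ a c w) fun u v => by
        have := hm₁ u v
        unfold bump; split_ifs <;> linarith
      exact ⟨m', .forward ht hm'⟩
    -- Half of `η` covers the reduction by `w` together with the tolerance left to the rest of the
    -- chain; a third of the reading ensures `w ≤ m₁ c a`.
    · refine ⟨min (η / 2) (m c a / 3), by positivity, fun w hw hwη m₁ hm₁ => ?_⟩
      have l1 : min (η / 2) (m c a / 3) ≤ η / 2 := min_le_left _ _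
      have l2 : min (η / 2) (m c a / 3) ≤ m c a / 3 := min_le_right _ _
      obtain ⟨m', hm'⟩ := ih w hw (by linarith) (bump m₁ c a (-w)) fun u v => by
        have := hm₁ u v
        unfold bump; split_ifs <;> linarith
      exact ⟨m', .backward ht (by linarith [hm₁ c a]) hm'⟩

/-- Otherwise, by continuity, a small enough pour from `a` to `b` would still leave `a` the higher
one. -/
theorem Balanced.level_le {m : Meters T} (hb : Balanced α θ₁ θ₂ fill tap m)
    {a b : Vessel T} (h : ReflTransGen (Residual tap m) a b) (ha : 0 < water fill m a) :
    level α θ₁ θ₂ a (water fill m a) ≤ level α θ₁ θ₂ b (water fill m b) := by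
  by_contra! hlt
  have hab : a ≠ b := by rintro rfl; exact lt_irrefl _ hlt
  obtain ⟨η, hη, hpour⟩ := exists_pour_of_residual h
  have c1 : Continuous fun w => level α θ₁ θ₂ b (water fill m b + w) :=
    (continuous_level b).comp (by fun_prop)
  have c2 : Continuous fun w => level α θ₁ θ₂ a (water fill m a - w) :=
    (continuous_level a).comp (by fun_prop)
  have ev : ∀ᶠ w in nhds (0 : ℝ), level α θ₁ θ₂ b (water fill m b + w) <
      level α θ₁ θ₂ a (water fill m a - w) :=
    (c1.tendsto 0).eventually_lt (c2.tendsto 0) (by simpa using hlt)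
  have ev2 : ∀ᶠ w in nhdsWithin (0 : ℝ) (Set.Ioi 0), 0 < w ∧ w < η ∧ w < water fill m a ∧
      level α θ₁ θ₂ b (water fill m b + w) < level α θ₁ θ₂ a (water fill m a - w) := by
    filter_upwards [self_mem_nhdsWithin, nhdsWithin_le_nhds (Iio_mem_nhds hη),
      nhdsWithin_le_nhds (Iio_mem_nhds ha), nhdsWithin_le_nhds ev] with w h1 h2 h3 h4
    exact ⟨h1, h2, h3, h4⟩
  obtain ⟨w, hw, hwη, hwa, hl⟩ := ev2.exists
  obtain ⟨m', hm'⟩ := hpour w hw hwη m fun u v => by linarith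
  refine hb m' ⟨a, b, w, hab, hw, hwa.le, hm', ?_⟩
  rw [hm'.water_eq, hm'.water_eq]
  simpa [hab, hab.symm] using hl.le

/-- Prices of water in the vessels that certify the optimality of the meters. -/
structure IsPrice (α θ₁ θ₂ : ℝ) (fill : Vessel T → ℝ) (tap : Vessel T → Vessel T → Prop)
    (m : Meters T) (q : Vessel T → ℝ) : Prop where
  le : ∀ v, 1 / level α θ₁ θ₂ v (water fill m v) ≤ q v
  eq : ∀ v, 0 < water fill m v → q v = 1 / level α θ₁ θ₂ v (water fill m v)
  anti : ∀ u v, tap u v → q v ≤ q u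
  eq_of_pos : ∀ u v, 0 < m u v → q v = q u

/-- Complementary slackness. The tangent bound replaces utility by value at the prices `q`; in an
empty vessel `q` may exceed the slope, because the amount there can only grow. By `sum_mul_water`,
passing taps never gains value, and the passages recorded in `m` lose none. -/
theorem IsPrice.isOptimal (hα : 0 < α) (h₁ : 0 < θ₁) (h₂ : 0 < θ₂) {m : Meters T}
    {q : Vessel T → ℝ} (hq : IsPrice α θ₁ θ₂ fill tap m q) (hm : Admissible fill tap m) :
    IsOptimal α θ₁ θ₂ fill tap m := by
  refine ⟨hm, fun m' hm' => ?_⟩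
  have e1 : totalUtil α θ₁ θ₂ fill m' - totalUtil α θ₁ θ₂ fill m ≤
      ∑ v, (q v * water fill m' v - q v * water fill m v) := by
    unfold totalUtil
    rw [← sum_sub_distrib]
    refine sum_le_sum fun v _ => ?_
    refine (util_sub_le hα h₁ h₂ v (hm.water_nonneg v) (hm'.water_nonneg v)).trans ?_
    rcases (hm.water_nonneg v).eq_or_lt with h0 | hpos
    · have := mul_le_mul_of_nonneg_left (hq.le v) (hm'.water_nonneg v)
      rw [← h0] at this ⊢
      linarith
    · rw [← hq.eq v hpos]
      exact le_of_eq (by ring)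
  rw [sum_sub_distrib, sum_mul_water, sum_mul_water, add_sub_add_left_eq_sub] at e1
  have e2 : ∑ u, ∑ v, m u v * (q v - q u) = 0 :=
    sum_eq_zero fun u _ => sum_eq_zero fun v _ => by
      rcases (hm.nonneg u v).eq_or_lt with h0 | hpos
      · rw [← h0, zero_mul]
      · rw [hq.eq_of_pos u v hpos, sub_self, mul_zero]
  have e3 : ∑ u, ∑ v, m' u v * (q v - q u) ≤ 0 :=
    sum_nonpos fun u _ => sum_nonpos fun v _ => by
      by_cases ht : tap u v
      · exact mul_nonpos_of_nonneg_of_nonpos (hm'.nonneg u v) (sub_nonpos.2 (hq.anti u v ht))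
      · rw [hm'.off u v ht, zero_mul]
  linarith

/-- In balanced water, the inverse of the lowest level within reach is a price. -/
theorem Balanced.exists_isPrice (hα : 0 < α) (h₁ : 0 < θ₁) (h₂ : 0 < θ₂) {m : Meters T}
    (hb : Balanced α θ₁ θ₂ fill tap m) (hm : Admissible fill tap m) :
    ∃ q, IsPrice α θ₁ θ₂ fill tap m q ∧ ∀ v, ∃ b, ReflTransGen (Residual tap m) v b ∧
      q v = 1 / level α θ₁ θ₂ b (water fill m b) := by
  have hex : ∀ v, ∃ b, ReflTransGen (Residual tap m) v b ∧ ∀ c,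
      ReflTransGen (Residual tap m) v c →
      level α θ₁ θ₂ b (water fill m b) ≤ level α θ₁ θ₂ c (water fill m c) := fun v =>
    Set.exists_min_image {b | ReflTransGen (Residual tap m) v b} _ (Set.toFinite _) ⟨v, .refl⟩
  choose f hf hmin using hex
  have hpos : ∀ v, 0 < level α θ₁ θ₂ v (water fill m v) := fun v =>
    level_pos hα h₁ h₂ v (hm.water_nonneg v)
  have hanti : ∀ u v, Residual tap m u v → 1 / level α θ₁ θ₂ (f v) (water fill m (f v)) ≤
      1 / level α θ₁ θ₂ (f u) (water fill m (f u)) := fun u v h =>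
    one_div_le_one_div_of_le (hpos _) (hmin u _ (.head h (hf v)))
  refine ⟨fun v => 1 / level α θ₁ θ₂ (f v) (water fill m (f v)), ⟨fun v => ?_, fun v hv => ?_,
    fun u v h => hanti u v (.inl h), fun u v h => ?_⟩, fun v => ⟨f v, hf v, rfl⟩⟩
  · exact one_div_le_one_div_of_le (hpos _) (hmin v v .refl)
  · exact congrArg (1 / ·) (le_antisymm (hmin v v .refl) (hb.level_le (hf v) hv))
  -- A tap with a positive reading is residual in both directions.
  · exact le_antisymm (hanti u v (.inl (hm.tap_of_pos h)))
      (hanti v u (.inr ⟨hm.tap_of_pos h, h⟩))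

theorem Balanced.isOptimal (hα : 0 < α) (h₁ : 0 < θ₁) (h₂ : 0 < θ₂) {m : Meters T}
    (hb : Balanced α θ₁ θ₂ fill tap m) (hm : Admissible fill tap m) :
    IsOptimal α θ₁ θ₂ fill tap m :=
  let ⟨_, hq, _⟩ := hb.exists_isPrice hα h₁ h₂ hm
  hq.isOptimal hα h₁ h₂ hm

/-! ### The water can settle -/

/-- Cut the walk at its last visit to `a`. Iterated, this makes the walk a simple path. -/
theorem exists_step_avoiding {V : Type*} [DecidableEq V] {r : V → V → Prop} {S : Finset V}
    {a b : V} (h : ReflTransGen (fun u v => u ∈ S ∧ v ∈ S ∧ r u v) a b) (hab : a ≠ b) :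
    ∃ c, a ∈ S ∧ c ∈ S ∧ c ≠ a ∧ r a c ∧
      ReflTransGen (fun u v => u ∈ S.erase a ∧ v ∈ S.erase a ∧ r u v) c b := by
  have key : ∀ x, ReflTransGen (fun u v => u ∈ S ∧ v ∈ S ∧ r u v) x b →
      (x ≠ a ∧ ReflTransGen (fun u v => u ∈ S.erase a ∧ v ∈ S.erase a ∧ r u v) x b) ∨
      ∃ c, a ∈ S ∧ c ∈ S ∧ c ≠ a ∧ r a c ∧
        ReflTransGen (fun u v => u ∈ S.erase a ∧ v ∈ S.erase a ∧ r u v) c b := by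
    intro x hx
    induction hx using ReflTransGen.head_induction_on with
    | refl => exact .inl ⟨hab.symm, .refl⟩
    | @head x y hxy _ ih =>
      rcases ih with ⟨hya, hy⟩ | h
      · by_cases hxa : x = a
        · subst hxa
          exact .inr ⟨y, hxy.1, hxy.2.1, hya, hxy.2.2, hy⟩
        · exact .inl ⟨hxa, .head ⟨mem_erase.2 ⟨hxa, hxy.1⟩, mem_erase.2 ⟨hya, hxy.2.1⟩,
            hxy.2.2⟩ hy⟩
      · exact .inr h
  rcases key a h with h | h
  · exact absurd rfl h.1
  · exact h

/-- Conducting water from `a` directly to `b` brings the meters `m` closer to the meters `t`. -/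
def Toward (tap : Vessel T → Vessel T → Prop) (m t : Meters T) (a b : Vessel T) : Prop :=
  (tap a b ∧ m a b < t a b) ∨ (tap b a ∧ t b a < m b a)

/-- Along a simple path each meter changes at most once. The amount is the minimum of `e` and the
gaps met on the way, so no target is overshot and one bound is attained. `S` holds the vessels still
allowed. `ε` is fixed before `m₁` because the recursive call acts on meters already bumped by `ε`.
-/
theorem exists_pour_toward {m t : Meters T} (ht : ∀ u v, 0 ≤ t u v) {b : Vessel T}
    (S : Finset (Vessel T)) : ∀ a,
    ReflTransGen (fun u v => u ∈ S ∧ v ∈ S ∧ Toward tap m t u v) a b → ∀ e > 0,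
    ∃ ε, 0 < ε ∧ ε ≤ e ∧ ∀ m₁ : Meters T, (∀ u ∈ S, ∀ v ∈ S, m₁ u v = m u v) →
      ∃ m', Pour tap ε m₁ a b m' ∧
        (∀ u v, m' u v = m₁ u v ∨ (u ∈ S ∧ v ∈ S ∧ m u v ≠ t u v)) ∧
        (ε = e ∨ ∃ u v, m₁ u v ≠ t u v ∧ m' u v = t u v) := by
  induction S using Finset.strongInduction with
  | H S ih =>
  intro a hab e he
  by_cases hne : a = b
  · subst hne
    exact ⟨e, he, le_rfl, fun m₁ _ => ⟨m₁, .stop_here _ _, fun _ _ => .inl rfl, .inl rfl⟩⟩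
  obtain ⟨c, haS, hcS, hca, hac, hcb⟩ := exists_step_avoiding hab hne
  -- `σ = ±1` is the direction of passage and `κ` the gap, which unifies the two cases.
  have step : ∃ u₀ ∈ S, ∃ v₀ ∈ S, (u₀ = a ∨ v₀ = a) ∧ m u₀ v₀ ≠ t u₀ v₀ ∧ ∃ κ > 0, ∃ σ : ℝ,
      m u₀ v₀ + σ * κ = t u₀ v₀ ∧ ∀ ε ≤ κ, ∀ m₁ m' : Meters T, m₁ u₀ v₀ = m u₀ v₀ →
        Pour tap ε (bump m₁ u₀ v₀ (σ * ε)) c b m' → Pour tap ε m₁ a b m' := by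
    rcases hac with ⟨htap, hlt⟩ | ⟨htap, hlt⟩
    · refine ⟨a, haS, c, hcS, .inl rfl, hlt.ne, t a c - m a c, sub_pos.2 hlt, 1, by ring,
        fun ε _ m₁ m' _ hp => .forward htap ?_⟩
      rwa [one_mul] at hp
    · refine ⟨c, hcS, a, haS, .inr rfl, hlt.ne', m c a - t c a, sub_pos.2 hlt, -1, by ring,
        fun ε hε m₁ m' h hp => .backward htap (by linarith [ht c a]) ?_⟩
      rwa [neg_one_mul] at hp
  obtain ⟨u₀, hu₀, v₀, hv₀, huva, hmt, κ, hκ, σ, hσ, hpour⟩ := step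
  obtain ⟨ε, hε, hεe, hrest⟩ := ih _ (erase_ssubset haS) c hcb (min e κ) (lt_min he hκ)
  refine ⟨ε, hε, hεe.trans (min_le_left _ _), fun m₁ hm₁ => ?_⟩
  -- The meter just passed touches `a`, so the rest of the path leaves it alone.
  have hnot : ¬ (u₀ ∈ S.erase a ∧ v₀ ∈ S.erase a) := by
    rintro ⟨h1, h2⟩
    rcases huva with rfl | rfl
    · exact notMem_erase _ _ h1
    · exact notMem_erase _ _ h2
  have hbump : ∀ u v, ¬ (u = u₀ ∧ v = v₀) → bump m₁ u₀ v₀ (σ * ε) u v = m₁ u v := fun u v h => by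
    rw [bump, if_neg h, add_zero]
  obtain ⟨m', hp, hm', hhit⟩ := hrest (bump m₁ u₀ v₀ (σ * ε)) fun u hu v hv => by
    rw [hbump, hm₁ u (mem_of_mem_erase hu) v (mem_of_mem_erase hv)]
    rintro ⟨rfl, rfl⟩
    exact hnot ⟨hu, hv⟩
  have hm'₀ : m' u₀ v₀ = m u₀ v₀ + σ * ε := by
    rcases hm' u₀ v₀ with h | h
    · rw [h, bump, if_pos ⟨rfl, rfl⟩, hm₁ _ hu₀ _ hv₀]
    · exact absurd ⟨h.1, h.2.1⟩ hnot
  refine ⟨m', hpour ε (hεe.trans (min_le_right _ _)) m₁ m' (hm₁ _ hu₀ _ hv₀) hp,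
    fun u v => ?_, ?_⟩
  · by_cases huv : u = u₀ ∧ v = v₀
    · obtain ⟨rfl, rfl⟩ := huv
      exact .inr ⟨hu₀, hv₀, hmt⟩
    · rcases hm' u v with h | h
      · exact .inl (h.trans (hbump u v huv))
      · exact .inr ⟨mem_of_mem_erase h.1, mem_of_mem_erase h.2.1, h.2.2⟩
  · by_cases hκε : ε = κ
    · exact .inr ⟨u₀, v₀, by rwa [hm₁ _ hu₀ _ hv₀], by rw [hm'₀, hκε, hσ]⟩
    rcases hhit with h | ⟨u, v, h1, h2⟩
    · rcases min_choice e κ with h' | h'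
      · exact .inl (h.trans h')
      · exact absurd (h.trans h') hκε
    · by_cases huv : u = u₀ ∧ v = v₀
      · obtain ⟨rfl, rfl⟩ := huv
        refine absurd h2 ?_
        rcases hm' u v with h | h
        · rwa [h]
        · exact absurd ⟨h.1, h.2.1⟩ hnot
      · exact .inr ⟨u, v, by rwa [hbump u v huv] at h1, h2⟩

/-- If some vessel holds more water than it should, it can conduct water toward a vessel that holds
less than it should. -/
theorem exists_toward_lt {m t : Meters T} (hm : Admissible fill tap m) (ht : Admissible fill tap t)
    {a : Vessel T} (ha : water fill t a < water fill m a) :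
    ∃ b, ReflTransGen (Toward tap m t) a b ∧ water fill m b < water fill t b := by
  classical
  by_contra! hcon
  -- The indicator of the set reachable from `a`. No step toward `t` leaves this set, so across its
  -- border `m` carries at least as much out and at most as much in as `t`, and the set cannot hold
  -- more water under `m`.
  let q : Vessel T → ℝ := fun v => if ReflTransGen (Toward tap m t) a v then 1 else 0
  have h1 : ∑ v, q v * water fill t v < ∑ v, q v * water fill m v := by
    refine sum_lt_sum (fun v _ => ?_) ⟨a, mem_univ a, ?_⟩
    · by_cases hv : ReflTransGen (Toward tap m t) a v
      · simpa [q, hv] using hcon v hv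
      · simp [q, hv]
    · simpa [q, ReflTransGen.refl] using ha
  rw [sum_mul_water, sum_mul_water, add_lt_add_iff_left] at h1
  refine h1.not_ge (sum_le_sum fun u _ => sum_le_sum fun v _ => ?_)
  by_cases htap : tap u v
  · by_cases hu : ReflTransGen (Toward tap m t) a u <;>
      by_cases hv : ReflTransGen (Toward tap m t) a v
    · simp [q, hu, hv]
    · have : t u v ≤ m u v := le_of_not_gt fun h => hv (hu.tail (.inl ⟨htap, h⟩))
      simpa [q, hu, hv] using this
    · have : m u v ≤ t u v := le_of_not_gt fun h => hu (hv.tail (.inr ⟨htap, h⟩))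
      simpa [q, hu, hv] using this
    · simp [q, hu, hv]
  · simp [hm.off u v htap, ht.off u v htap]

/-- A step toward `t` can be undone at `t`: a meter that has to rise reads a positive amount there.
-/
theorem reflTransGen_residual_of_toward {m t : Meters T} (hm : ∀ u v, 0 ≤ m u v) {a b : Vessel T}
    (h : ReflTransGen (Toward tap m t) a b) : ReflTransGen (Residual tap t) b a := by
  induction h with
  | refl => exact .refl
  | tail _ h ih =>
    refine .head ?_ ih
    rcases h with ⟨h1, h2⟩ | ⟨h1, _⟩
    · exact .inr ⟨h1, (hm _ _).trans_lt h2⟩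
    · exact .inl h1

open Classical in
/-- The number of meter readings and amounts of water by which `m` differs from `t`. -/
noncomputable def discrepancy (fill : Vessel T → ℝ) (m t : Meters T) : ℕ :=
  #{p : Vessel T × Vessel T | m p.1 p.2 ≠ t p.1 p.2} +
    #{v : Vessel T | water fill m v ≠ water fill t v}

/-- Pour from an overfull `a` to an underfull `b`, at most up to their targets. In the balanced `t`
the level of `b` is at most that of `a`, and stopping short of the targets preserves this order, so
the flow is admissible. -/
theorem exists_flow_discrepancy_lt (hα : 0 < α) (h₁ : 0 < θ₁) (h₂ : 0 < θ₂) {m t : Meters T}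
    (hm : Admissible fill tap m) (ht : IsOptimal α θ₁ θ₂ fill tap t)
    (hne : water fill m ≠ water fill t) :
    ∃ m', Flow α θ₁ θ₂ fill tap m m' ∧ discrepancy fill m' t < discrepancy fill m t := by
  classical
  obtain ⟨a, ha⟩ : ∃ a, water fill t a < water fill m a := by
    by_contra! hcon
    have := (sum_eq_sum_iff_of_le fun v _ => hcon v).1
      ((sum_water fill m).trans (sum_water fill t).symm)
    exact hne (funext fun v => this v (mem_univ v))
  obtain ⟨b, hab, hb⟩ := exists_toward_lt hm ht.1 ha
  have hne' : a ≠ b := by rintro rfl; exact lt_asymm ha hb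
  have hlevel := (ht.balanced hα h₁ h₂).level_le (reflTransGen_residual_of_toward hm.nonneg hab)
    ((hm.water_nonneg b).trans_lt hb)
  obtain ⟨ε, hε, hεe, hpour⟩ := exists_pour_toward (m := m) ht.1.nonneg univ a
    (by simpa using hab)
    (min (water fill m a - water fill t a) (water fill t b - water fill m b))
    (lt_min (sub_pos.2 ha) (sub_pos.2 hb))
  obtain ⟨m', hp, hm', hhit⟩ := hpour m fun _ _ _ _ => rfl
  have hεa := hεe.trans (min_le_left _ _)
  have hεb := hεe.trans (min_le_right _ _)
  have wa := hp.water_eq (fill := fill) a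
  have wb := hp.water_eq (fill := fill) b
  simp only [hne', hne'.symm, if_true, if_false] at wa wb
  have hta := ht.1.water_nonneg a
  refine ⟨m', ⟨a, b, ε, hne', hε, by linarith, hp, ?_⟩, ?_⟩
  · calc _ ≤ level α θ₁ θ₂ b (water fill t b) := level_mono h₁ h₂ b (by linarith)
      _ ≤ level α θ₁ θ₂ a (water fill t a) := hlevel
      _ ≤ _ := level_mono h₁ h₂ a (by linarith)
  have s1 : Finset.filter (fun p : Vessel T × Vessel T => m' p.1 p.2 ≠ t p.1 p.2) univ ⊆
      Finset.filter (fun p : Vessel T × Vessel T => m p.1 p.2 ≠ t p.1 p.2) univ := fun p hp => by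
    simp only [mem_filter, mem_univ, true_and] at hp ⊢
    rcases hm' p.1 p.2 with h | h
    · rwa [h] at hp
    · exact h.2.2
  have s2 : Finset.filter (fun v : Vessel T => water fill m' v ≠ water fill t v) univ ⊆
      Finset.filter (fun v : Vessel T => water fill m v ≠ water fill t v) univ := fun v hv => by
    simp only [mem_filter, mem_univ, true_and] at hv ⊢
    by_cases hva : v = a
    · subst hva; exact ha.ne'
    by_cases hvb : v = b
    · subst hvb; exact hb.ne
    · simpa [hp.water_eq (fill := fill) v, hva, hvb] using hv
  unfold discrepancy
  rcases hhit with h | ⟨u, v, h1, h2⟩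
  · refine add_lt_add_of_le_of_lt (card_le_card s1) (card_lt_card ⟨s2, fun hs => ?_⟩)
    rcases min_choice (water fill m a - water fill t a) (water fill t b - water fill m b)
      with h' | h'
    · have := hs (mem_filter.2 ⟨mem_univ a, ha.ne'⟩)
      exact (mem_filter.1 this).2 (by linarith)
    · have := hs (mem_filter.2 ⟨mem_univ b, hb.ne⟩)
      exact (mem_filter.1 this).2 (by linarith)
  · refine add_lt_add_of_lt_of_le (card_lt_card ⟨s1, fun hs => ?_⟩) (card_le_card s2)
    have := hs (mem_filter.2 ⟨mem_univ (u, v), h1⟩)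
    exact (mem_filter.1 this).2 h2

/-- Once the amounts of water agree with those of `t`, the utility is maximal and the water
balanced, even if the meters still differ. -/
theorem exists_settles (hα : 0 < α) (h₁ : 0 < θ₁) (h₂ : 0 < θ₂) {t : Meters T}
    (ht : IsOptimal α θ₁ θ₂ fill tap t) {m : Meters T} (hm : Admissible fill tap m) :
    ∃ m', Settles α θ₁ θ₂ fill tap m m' := by
  induction hN : discrepancy fill m t using Nat.strong_induction_on generalizing m with
  | _ N ih =>
  by_cases heq : water fill m = water fill t
  · have : IsOptimal α θ₁ θ₂ fill tap m :=
      ⟨hm, by simpa only [totalUtil, heq] using ht.2⟩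
    exact ⟨m, .refl, this.balanced hα h₁ h₂⟩
  · obtain ⟨m₁, hf, hlt⟩ := exists_flow_discrepancy_lt hα h₁ h₂ hm ht heq
    obtain ⟨m', hs, hb⟩ := ih _ (hN ▸ hlt) (hf.admissible hm) rfl
    exact ⟨m', .head hf hs, hb⟩

theorem Settles.admissible {m m' : Meters T} (h : Settles α θ₁ θ₂ fill tap m m')
    (hm : Admissible fill tap m) : Admissible fill tap m' := by
  obtain ⟨h, -⟩ := h
  induction h with
  | refl => exact hm
  | tail _ hf ih => exact hf.admissible ih

/-! ### The outcome of the algorithm -/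

theorem OpenTap.potential {n : ℕ} {a b : Vessel T} (h : OpenTap n a b) :
    (b.1 : ℕ) + b.2 = a.1 + a.2 + 1 := by
  rcases h with ⟨h1, h2⟩ | ⟨⟨h1, h2, h3⟩, -⟩
  · rw [h1]; omega
  · rw [h1, h2, h3]; simp; omega

theorem OpenTap.succ {n : ℕ} {a b : Vessel T} (h : OpenTap n a b) : OpenTap (n + 1) a b :=
  h.imp_right fun h => ⟨h.1, by omega⟩

theorem admissible_zero (hfill : ∀ v, 0 ≤ fill v) : Admissible fill tap 0 :=
  ⟨fun _ _ => le_rfl, fun _ _ _ => rfl, fun v => by simpa [water] using hfill v⟩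

theorem Reads.admissible_balanced (hfill : ∀ v, 0 ≤ fill v) {n : ℕ} {m : Meters T}
    (h : Reads α θ₁ θ₂ fill n m) :
    Admissible fill (OpenTap n) m ∧ Balanced α θ₁ θ₂ fill (OpenTap n) m := by
  induction h with
  | right h => exact ⟨h.admissible (admissible_zero hfill), h.2⟩
  | down _ h ih => exact ⟨h.admissible (ih.1.mono fun a b => OpenTap.succ), h.2⟩

theorem exists_reads (hα : 0 < α) (h₁ : 0 < θ₁) (h₂ : 0 < θ₂) (hfill : ∀ v, 0 ≤ fill v) (n : ℕ) :
    ∃ m, Reads α θ₁ θ₂ fill n m := by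
  have hopt : ∀ n, ∃ t, IsOptimal α θ₁ θ₂ fill (OpenTap n) t := fun n =>
    exists_isOptimal hα hfill fun a b => OpenTap.potential
  induction n with
  | zero =>
    obtain ⟨t, ht⟩ := hopt 0
    obtain ⟨m, hm⟩ := exists_settles hα h₁ h₂ ht (admissible_zero hfill)
    exact ⟨m, .right hm⟩
  | succ n ih =>
    obtain ⟨m₀, h₀⟩ := ih
    obtain ⟨t, ht⟩ := hopt (n + 1)
    obtain ⟨m, hm⟩ := exists_settles hα h₁ h₂ ht
      ((h₀.admissible_balanced hfill).1.mono fun a b => OpenTap.succ)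
    exact ⟨m, .down h₀ hm⟩

/-! ### Policies and meters -/

theorem initialWater_nonneg (hα : 0 < α) (hE : ∀ i, 0 ≤ E i) (hE' : ∀ i, 0 ≤ E' i)
    (v : Vessel T) : 0 ≤ initialWater α E E' v := by
  unfold initialWater
  split_ifs
  · exact hE _
  · exact div_nonneg (hE' _) hα.le

theorem weightedThroughput_eq (x : Policy T) :
    weightedThroughput θ₁ θ₂ x = θ₁ * throughput x.P + θ₂ * throughput x.P' := by
  simp only [weightedThroughput, throughput, mul_sum, sum_add_distrib]

theorem totalUtil_eq (m : Meters T) :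
    totalUtil α θ₁ θ₂ fill m = 2 * weightedThroughput θ₁ θ₂ (policyOf α fill m) := by
  rw [totalUtil, Fintype.sum_prod_type, Fin.sum_univ_two, weightedThroughput_eq, throughput,
    throughput, mul_sum, mul_sum, ← sum_add_distrib, ← sum_add_distrib, mul_sum]
  refine sum_congr rfl fun i _ => ?_
  simp only [util, policyOf, if_true, one_ne_zero, if_false]
  ring

theorem throughput_mono {p p' : Fin T → ℝ} (hp : ∀ i, 0 ≤ p i) (h : ∀ i, p i ≤ p' i) :
    throughput p ≤ throughput p' := by
  refine sum_le_sum fun i _ => ?_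
  have := hp i
  have := h i
  gcongr

theorem throughput_nonneg {p : Fin T → ℝ} (hp : ∀ i, 0 ≤ p i) : 0 ≤ throughput p :=
  sum_nonneg fun i _ => mul_nonneg (by norm_num) (Real.log_nonneg (by linarith [hp i]))

theorem weightedThroughput_mono (h₁ : 0 < θ₁) (h₂ : 0 < θ₂) {x y : Policy T}
    (hP : ∀ i, 0 ≤ x.P i) (hP' : ∀ i, 0 ≤ x.P' i) (h : ∀ i, x.P i ≤ y.P i)
    (h' : ∀ i, x.P' i ≤ y.P' i) :
    weightedThroughput θ₁ θ₂ x ≤ weightedThroughput θ₁ θ₂ y := by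
  rw [weightedThroughput_eq, weightedThroughput_eq]
  exact add_le_add (mul_le_mul_of_nonneg_left (throughput_mono hP h) h₁.le)
    (mul_le_mul_of_nonneg_left (throughput_mono hP' h') h₂.le)

section

variable {n : ℕ} {m : Meters T}

/-- Right taps into the first slots start in the first slots: energy causality. -/
theorem Admissible.sum_row_le (h : Admissible fill (OpenTap n) m) (r : Fin 2) (k : Fin T) :
    ∑ i ∈ Iic k, ∑ j, m (r, j) (r, i) ≤ ∑ i ∈ Iic k, ∑ j, m (r, i) (r, j) := by
  calc ∑ i ∈ Iic k, ∑ j, m (r, j) (r, i) = ∑ i ∈ Iic k, ∑ j ∈ Iic k, m (r, j) (r, i) := by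
        refine sum_congr rfl fun i hi => (sum_subset (subset_univ _) fun j _ hj => ?_).symm
        refine h.off _ _ fun ht => hj ?_
        rw [mem_Iic] at hi ⊢
        rcases ht with ⟨_, h2⟩ | ⟨⟨_, _, h2⟩, _⟩
        · have : j ≤ i := Fin.le_def.2 (by simp only at h2; omega)
          exact this.trans hi
        · exact (le_of_eq h2).trans hi
    _ = ∑ j ∈ Iic k, ∑ i ∈ Iic k, m (r, j) (r, i) := sum_comm
    _ ≤ _ := sum_le_sum fun j _ =>
        sum_le_sum_of_subset_of_nonneg (subset_univ _) fun i _ _ => h.nonneg _ _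

theorem Admissible.sum_down_right (h : Admissible fill (OpenTap n) m) (i : Fin T) :
    ∑ j, m (0, i) (1, j) = m (0, i) (1, i) := by
  refine sum_eq_single i (fun j _ hj => h.off _ _ ?_) (by simp)
  rintro (⟨h1, _⟩ | ⟨⟨_, _, h1⟩, _⟩)
  · exact absurd h1 (by simp)
  · exact hj h1.symm

theorem Admissible.sum_down_left (h : Admissible fill (OpenTap n) m) (i : Fin T) :
    ∑ j, m (0, j) (1, i) = m (0, i) (1, i) := by
  refine sum_eq_single i (fun j _ hj => h.off _ _ ?_) (by simp)
  rintro (⟨h1, _⟩ | ⟨⟨_, _, h1⟩, _⟩)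
  · exact absurd h1 (by simp)
  · exact hj h1

theorem Admissible.up_eq_zero (h : Admissible fill (OpenTap n) m) (i j : Fin T) :
    m (1, i) (0, j) = 0 := by
  refine h.off _ _ ?_
  rintro (⟨h1, _⟩ | ⟨⟨h1, _⟩, _⟩) <;> exact absurd h1 (by simp)

theorem Admissible.water_upper (h : Admissible fill (OpenTap n) m) (i : Fin T) :
    water fill m (0, i) =
      fill (0, i) + ∑ j, m (0, j) (0, i) - ∑ j, m (0, i) (0, j) - m (0, i) (1, i) := by
  simp only [water, Fintype.sum_prod_type, Fin.sum_univ_two, h.up_eq_zero, h.sum_down_right,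
    sum_const_zero]
  ring

theorem Admissible.water_lower (h : Admissible fill (OpenTap n) m) (i : Fin T) :
    water fill m (1, i) =
      fill (1, i) + ∑ j, m (1, j) (1, i) - ∑ j, m (1, i) (1, j) + m (0, i) (1, i) := by
  simp only [water, Fintype.sum_prod_type, Fin.sum_univ_two, h.up_eq_zero, h.sum_down_left,
    sum_const_zero]
  ring

theorem Admissible.policyOf_mem_feasible (hα : 0 < α)
    (h : Admissible (initialWater α E E') (OpenTap n) m) :
    policyOf α (initialWater α E E') m ∈ feasible α E E' := by
  have hP : ∀ k, ∑ i ∈ Iic k, water (initialWater α E E') m (0, i) ≤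
      ∑ i ∈ Iic k, (E i - m (0, i) (1, i)) := fun k => by
    have := h.sum_row_le 0 k
    simp only [h.water_upper, initialWater, if_true, sum_sub_distrib, sum_add_distrib]
    linarith
  refine ⟨fun i => h.nonneg _ _, fun i => h.water_nonneg _,
    fun i => mul_nonneg hα.le (h.water_nonneg _), hP, fun k => ?_, fun k => ?_⟩
  · have := mul_le_mul_of_nonneg_left (h.sum_row_le 1 k) hα.le
    have e : ∀ i, α * (E' i / α) = E' i := fun i => by field_simp
    simp only [policyOf, h.water_lower, initialWater, one_ne_zero, if_false, ← mul_sum,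
      sum_sub_distrib, sum_add_distrib]
    have e2 : α * ∑ i ∈ Iic k, E' i / α = ∑ i ∈ Iic k, E' i := by
      rw [mul_sum]; exact sum_congr rfl fun i _ => e i
    linarith
  -- Causality of the transfers follows from that of user 1, since powers are nonnegative.
  · have h1 := hP k
    have h2 : 0 ≤ ∑ i ∈ Iic k, water (initialWater α E E') m (0, i) :=
      sum_nonneg fun i _ => h.water_nonneg _
    simp only [sum_sub_distrib] at h1
    simp only [policyOf]
    linarith

end

open Classical in
/-- Meters that realize a policy. -/
noncomputable def metersOf (α : ℝ) (E E' : Fin T → ℝ) (x : Policy T) : Meters T := fun u v =>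
  if IsRightTap u v then
    ∑ j ∈ Iic u.2, if u.1 = 0 then E j - x.δ j - x.P j else (E' j + α * x.δ j - x.P' j) / α
  else if IsDownTap u v then x.δ u.2 else 0

theorem sum_pred_sum_Iic (g : Fin T → ℝ) (i : Fin T) :
    (∑ j : Fin T, if (j : ℕ) + 1 = i then ∑ l ∈ Iic j, g l else 0) = ∑ l ∈ Iio i, g l := by
  rcases Nat.eq_zero_or_pos (i : ℕ) with h | h
  · rw [sum_eq_zero fun j _ => if_neg (by omega)]
    refine (sum_eq_zero fun l hl => ?_).symm
    rw [mem_Iio, Fin.lt_def] at hl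
    omega
  · obtain ⟨j₀, hj₀⟩ : ∃ j₀ : Fin T, (j₀ : ℕ) + 1 = i := ⟨⟨i - 1, by omega⟩, by simp only; omega⟩
    rw [sum_eq_single j₀ (fun j _ hj => if_neg fun h' => hj (Fin.ext (by omega))) (by simp),
      if_pos hj₀]
    refine sum_congr (Finset.ext fun l => ?_) fun _ _ => rfl
    rw [mem_Iic, mem_Iio, Fin.le_def, Fin.lt_def]
    omega

theorem sum_succ_le {G : ℝ} (hG : 0 ≤ G) (i : Fin T) :
    (∑ j : Fin T, if (i : ℕ) + 1 = j then G else 0) ≤ G := by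
  by_cases h : (i : ℕ) + 1 < T
  · rw [sum_eq_single ⟨i + 1, h⟩
      (fun j _ hj => if_neg fun h' => hj (Fin.ext h'.symm)) (by simp), if_pos rfl]
  · rw [sum_eq_zero fun j _ => if_neg (by omega)]
    exact hG

section

variable {x : Policy T}

theorem metersOf_upper (i j : Fin T) : metersOf α E E' x (0, i) (0, j) =
    if (i : ℕ) + 1 = j then ∑ l ∈ Iic i, (E l - x.δ l - x.P l) else 0 := by
  simp [metersOf, IsRightTap, IsDownTap]

theorem metersOf_lower (i j : Fin T) : metersOf α E E' x (1, i) (1, j) =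
    if (i : ℕ) + 1 = j then ∑ l ∈ Iic i, (E' l + α * x.δ l - x.P' l) / α else 0 := by
  simp [metersOf, IsRightTap, IsDownTap]

theorem metersOf_down (i j : Fin T) : metersOf α E E' x (0, i) (1, j) =
    if i = j then x.δ i else 0 := by
  simp [metersOf, IsRightTap, IsDownTap]

theorem metersOf_up (i j : Fin T) : metersOf α E E' x (1, i) (0, j) = 0 := by
  simp [metersOf, IsRightTap, IsDownTap]

theorem sum_upper_nonneg (hx : x ∈ feasible α E E') (k : Fin T) :
    0 ≤ ∑ l ∈ Iic k, (E l - x.δ l - x.P l) := by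
  rw [sum_sub_distrib]
  exact sub_nonneg.2 (hx.2.2.2.1 k)

theorem sum_lower_nonneg (hα : 0 < α) (hx : x ∈ feasible α E E') (k : Fin T) :
    0 ≤ ∑ l ∈ Iic k, (E' l + α * x.δ l - x.P' l) / α := by
  rw [← sum_div, sum_sub_distrib]
  exact div_nonneg (sub_nonneg.2 (hx.2.2.2.2.1 k)) hα.le

/-- Right inflow minus outflow telescopes to leave `x.P i`, except in the last slot, which has no
right tap and keeps the unspent surplus. -/
theorem le_water_upper (hx : x ∈ feasible α E E') (i : Fin T) :
    x.P i ≤ water (initialWater α E E') (metersOf α E E' x) (0, i) := by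
  have h1 := sum_succ_le (sum_upper_nonneg hx i) i
  simp only [water, Fintype.sum_prod_type, Fin.sum_univ_two, metersOf_upper, metersOf_up,
    metersOf_down, sum_pred_sum_Iic, sum_const_zero, initialWater, if_true, sum_ite_eq, mem_univ]
  have h2 := sum_Iio_add_eq_sum_Iic (f := fun l => E l - x.δ l - x.P l) i
  linarith

theorem le_water_lower (hα : 0 < α) (hx : x ∈ feasible α E E') (i : Fin T) :
    x.P' i / α ≤ water (initialWater α E E') (metersOf α E E' x) (1, i) := by
  have h1 := sum_succ_le (sum_lower_nonneg hα hx i) i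
  simp only [water, Fintype.sum_prod_type, Fin.sum_univ_two, metersOf_lower, metersOf_up,
    metersOf_down, sum_pred_sum_Iic, sum_const_zero, initialWater, one_ne_zero, if_false,
    sum_ite_eq', mem_univ, if_true]
  have h2 := sum_Iio_add_eq_sum_Iic (f := fun l => (E' l + α * x.δ l - x.P' l) / α) i
  have h3 : (E' i + α * x.δ i - x.P' i) / α = E' i / α + x.δ i - x.P' i / α := by field_simp
  linarith

theorem admissible_metersOf (hα : 0 < α) (hx : x ∈ feasible α E E') :
    Admissible (initialWater α E E') (OpenTap T) (metersOf α E E' x) := by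
  refine ⟨fun u v => ?_, fun u v huv => ?_, ?_⟩
  · unfold metersOf
    split_ifs with h1 h2 h2
    · exact sum_upper_nonneg hx _
    · exact sum_lower_nonneg hα hx _
    · exact hx.1 _
    · exact le_rfl
  · unfold metersOf
    rw [if_neg fun h => huv (.inl h), if_neg fun h => huv (.inr ⟨h, by omega⟩)]
  · rintro ⟨r, i⟩
    fin_cases r
    · exact (hx.2.1 i).trans (le_water_upper hx i)
    · exact (div_nonneg (hx.2.2.1 i) hα.le).trans (le_water_lower hα hx i)

end

/-- Optimal meters with all taps open yield an optimal policy. -/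
theorem IsOptimal.isMaxOn (hα : 0 < α) (h₁ : 0 < θ₁) (h₂ : 0 < θ₂) {m : Meters T}
    (h : IsOptimal α θ₁ θ₂ (initialWater α E E') (OpenTap T) m) :
    IsMaxOn (weightedThroughput θ₁ θ₂) (feasible α E E')
      (policyOf α (initialWater α E E') m) := fun x hx => by
  have e1 := h.2 _ (admissible_metersOf hα hx)
  rw [totalUtil_eq, totalUtil_eq] at e1
  have e2 : weightedThroughput θ₁ θ₂ x ≤
      weightedThroughput θ₁ θ₂ (policyOf α (initialWater α E E') (metersOf α E E' x)) :=
    weightedThroughput_mono h₁ h₂ hx.2.1 hx.2.2.1 (le_water_upper hx) fun i => by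
      have := le_water_lower hα hx i
      rw [div_le_iff₀ hα] at this
      simpa [policyOf, mul_comm] using this
  simp only [Set.mem_ofPred_eq]
  linarith

theorem exists_isOutput (hα : 0 < α) (hE : ∀ i, 0 ≤ E i) (hE' : ∀ i, 0 ≤ E' i) (h₁ : 0 < θ₁)
    (h₂ : 0 < θ₂) : ∃ x, IsOutput α θ₁ θ₂ E E' x :=
  let ⟨m, hm⟩ := exists_reads hα h₁ h₂ (initialWater_nonneg hα hE hE') T
  ⟨_, m, hm, rfl⟩

theorem IsOutput.mem_feasible (hα : 0 < α) (hE : ∀ i, 0 ≤ E i) (hE' : ∀ i, 0 ≤ E' i)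
    {x : Policy T} (hx : IsOutput α θ₁ θ₂ E E' x) : x ∈ feasible α E E' := by
  obtain ⟨m, hm, rfl⟩ := hx
  exact (hm.admissible_balanced (initialWater_nonneg hα hE hE')).1.policyOf_mem_feasible hα

theorem IsOutput.isMaxOn (hα : 0 < α) (hE : ∀ i, 0 ≤ E i) (hE' : ∀ i, 0 ≤ E' i) (h₁ : 0 < θ₁)
    (h₂ : 0 < θ₂) {x : Policy T} (hx : IsOutput α θ₁ θ₂ E E' x) :
    IsMaxOn (weightedThroughput θ₁ θ₂) (feasible α E E') x := by
  obtain ⟨m, hm, rfl⟩ := hx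
  obtain ⟨hadm, hbal⟩ := hm.admissible_balanced (initialWater_nonneg hα hE hE')
  exact (hbal.isOptimal hα h₁ h₂ hadm).isMaxOn hα h₁ h₂

/-! ### The boundary of the capacity region -/

theorem mem_capacityRegion {R : ℝ × ℝ} : R ∈ capacityRegion α E E' ↔ ∃ x ∈ feasible α E E',
    0 ≤ R.1 ∧ 0 ≤ R.2 ∧ R.1 ≤ throughput x.P ∧ R.2 ≤ throughput x.P' := by
  simp only [capacityRegion, achievable, Set.mem_iUnion₂, exists_prop]
  rfl

theorem rates_mem_capacityRegion {x : Policy T} (hx : x ∈ feasible α E E') :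
    rates x ∈ capacityRegion α E E' :=
  mem_capacityRegion.2
    ⟨x, hx, throughput_nonneg hx.2.1, throughput_nonneg hx.2.2.1, le_rfl, le_rfl⟩

theorem weighted_le_of_isMaxOn (h₁ : 0 < θ₁) (h₂ : 0 < θ₂) {x : Policy T}
    (hmax : IsMaxOn (weightedThroughput θ₁ θ₂) (feasible α E E') x) {S : ℝ × ℝ}
    (hS : S ∈ capacityRegion α E E') :
    θ₁ * S.1 + θ₂ * S.2 ≤ θ₁ * (rates x).1 + θ₂ * (rates x).2 := by
  obtain ⟨y, hy, -, -, hy1, hy2⟩ := mem_capacityRegion.1 hS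
  have h := hmax hy
  simp only [Set.mem_ofPred_eq, weightedThroughput_eq] at h
  exact (add_le_add (mul_le_mul_of_nonneg_left hy1 h₁.le)
    (mul_le_mul_of_nonneg_left hy2 h₂.le)).trans h

theorem maximal_rates (h₁ : 0 < θ₁) (h₂ : 0 < θ₂) {x : Policy T} (hx : x ∈ feasible α E E')
    (hmax : IsMaxOn (weightedThroughput θ₁ θ₂) (feasible α E E') x) :
    Maximal (fun S => S ∈ capacityRegion α E E') (rates x) := by
  refine ⟨rates_mem_capacityRegion hx, fun S hS hle => ?_⟩
  have h := weighted_le_of_isMaxOn h₁ h₂ hmax hS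
  obtain ⟨l1, l2⟩ := hle
  have k1 := mul_le_mul_of_nonneg_left l1 h₁.le
  have k2 := mul_le_mul_of_nonneg_left l2 h₂.le
  exact ⟨le_of_mul_le_mul_left (by linarith) h₁, le_of_mul_le_mul_left (by linarith) h₂⟩

/-- A small diagonal shift of an interior point would stay in the region and raise the weighted sum.
-/
theorem rates_mem_frontier (h₁ : 0 < θ₁) (h₂ : 0 < θ₂) {x : Policy T}
    (hx : x ∈ feasible α E E')
    (hmax : IsMaxOn (weightedThroughput θ₁ θ₂) (feasible α E E') x) :
    rates x ∈ frontier (capacityRegion α E E') := by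
  refine ⟨subset_closure (rates_mem_capacityRegion hx), fun hint => ?_⟩
  have hc : Continuous fun ε : ℝ => ((rates x).1 + ε, (rates x).2 + ε) := by fun_prop
  have ev : ∀ᶠ ε in nhds (0 : ℝ),
      ((rates x).1 + ε, (rates x).2 + ε) ∈ interior (capacityRegion α E E') :=
    hc.continuousAt.eventually_mem (isOpen_interior.mem_nhds (by simpa using hint))
  have ev2 : ∀ᶠ ε in nhdsWithin (0 : ℝ) (Set.Ioi 0), 0 < ε ∧
      ((rates x).1 + ε, (rates x).2 + ε) ∈ interior (capacityRegion α E E') :=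
    (eventually_mem_nhdsWithin (s := Set.Ioi (0 : ℝ))).and (nhdsWithin_le_nhds ev)
  obtain ⟨ε, hε, hmem⟩ := ev2.exists
  have h := weighted_le_of_isMaxOn h₁ h₂ hmax (interior_subset hmem)
  simp only at h
  nlinarith [mul_pos h₁ hε, mul_pos h₂ hε]

/-! ### Concavity -/

/-- The combination of two policies with coefficients `a` and `b`. -/
def mix (a b : ℝ) (x y : Policy T) : Policy T where
  δ i := a * x.δ i + b * y.δ i
  P i := a * x.P i + b * y.P i
  P' i := a * x.P' i + b * y.P' i

theorem mix_mem_feasible {a b : ℝ} (ha : 0 ≤ a) (hb : 0 ≤ b) (hab : a + b = 1) {x y : Policy T}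
    (hx : x ∈ feasible α E E') (hy : y ∈ feasible α E E') : mix a b x y ∈ feasible α E E' := by
  obtain ⟨x1, x2, x3, x4, x5, x6⟩ := hx
  obtain ⟨y1, y2, y3, y4, y5, y6⟩ := hy
  have comb : ∀ {s t : ℝ} {s' t' : ℝ}, s ≤ t → s' ≤ t' → a * s + b * s' ≤ a * t + b * t' :=
    fun h h' => add_le_add (mul_le_mul_of_nonneg_left h ha) (mul_le_mul_of_nonneg_left h' hb)
  obtain rfl : a = 1 - b := by linarith
  refine ⟨fun i => ?_, fun i => ?_, fun i => ?_, fun k => ?_, fun k => ?_, fun k => ?_⟩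
  · exact add_nonneg (mul_nonneg ha (x1 i)) (mul_nonneg hb (y1 i))
  · exact add_nonneg (mul_nonneg ha (x2 i)) (mul_nonneg hb (y2 i))
  · exact add_nonneg (mul_nonneg ha (x3 i)) (mul_nonneg hb (y3 i))
  · refine Eq.trans_le ?_ ((comb (x4 k) (y4 k)).trans_eq ?_) <;>
      simp only [mix, mul_sum, ← sum_add_distrib]
    exact sum_congr rfl fun i _ => by ring
  · refine Eq.trans_le ?_ ((comb (x5 k) (y5 k)).trans_eq ?_) <;>
      simp only [mix, mul_sum, ← sum_add_distrib]
    exact sum_congr rfl fun i _ => by ring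
  · refine Eq.trans_le ?_ ((comb (x6 k) (y6 k)).trans_eq ?_) <;>
      simp only [mix, mul_sum, ← sum_add_distrib]
    exact sum_congr rfl fun i _ => by ring

theorem add_log_le {a b s t : ℝ} (ha : 0 ≤ a) (hb : 0 ≤ b) (hab : a + b = 1) (hs : 0 ≤ s)
    (ht : 0 ≤ t) : a * (1 / 2 * Real.log (1 + s)) + b * (1 / 2 * Real.log (1 + t)) ≤
      1 / 2 * Real.log (1 + (a * s + b * t)) := by
  have h := strictConcaveOn_log_Ioi.concaveOn.2 (x := 1 + s) (y := 1 + t)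
    (Set.mem_Ioi.2 (by linarith)) (Set.mem_Ioi.2 (by linarith)) ha hb hab
  have e : a * (1 + s) + b * (1 + t) = 1 + (a * s + b * t) := by linear_combination hab
  simp only [smul_eq_mul, e] at h
  linarith

theorem add_log_lt {a b s t : ℝ} (ha : 0 < a) (hb : 0 < b) (hab : a + b = 1) (hs : 0 ≤ s)
    (ht : 0 ≤ t) (hst : s ≠ t) :
    a * (1 / 2 * Real.log (1 + s)) + b * (1 / 2 * Real.log (1 + t)) <
      1 / 2 * Real.log (1 + (a * s + b * t)) := by
  have h := strictConcaveOn_log_Ioi.2 (x := 1 + s) (y := 1 + t)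
    (Set.mem_Ioi.2 (by linarith)) (Set.mem_Ioi.2 (by linarith)) (by simpa using hst) ha hb hab
  have e : a * (1 + s) + b * (1 + t) = 1 + (a * s + b * t) := by linear_combination hab
  simp only [smul_eq_mul, e] at h
  linarith

theorem add_throughput_le {a b : ℝ} (ha : 0 ≤ a) (hb : 0 ≤ b) (hab : a + b = 1)
    {p p' : Fin T → ℝ} (hp : ∀ i, 0 ≤ p i) (hp' : ∀ i, 0 ≤ p' i) :
    a * throughput p + b * throughput p' ≤ throughput fun i => a * p i + b * p' i := by
  unfold throughput
  rw [mul_sum, mul_sum, ← sum_add_distrib]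
  exact sum_le_sum fun i _ => add_log_le ha hb hab (hp i) (hp' i)

theorem add_throughput_lt {a b : ℝ} (ha : 0 < a) (hb : 0 < b) (hab : a + b = 1)
    {p p' : Fin T → ℝ} (hp : ∀ i, 0 ≤ p i) (hp' : ∀ i, 0 ≤ p' i) (hne : p ≠ p') :
    a * throughput p + b * throughput p' < throughput fun i => a * p i + b * p' i := by
  obtain ⟨j, hj⟩ := Function.ne_iff.1 hne
  unfold throughput
  rw [mul_sum, mul_sum, ← sum_add_distrib]
  exact sum_lt_sum (fun i _ => add_log_le ha.le hb.le hab (hp i) (hp' i))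
    ⟨j, mem_univ j, add_log_lt ha hb hab (hp j) (hp' j) hj⟩

/-- The powers of an optimal policy are unique. -/
theorem power_eq_of_isMaxOn (h₁ : 0 < θ₁) (h₂ : 0 < θ₂) {x y : Policy T}
    (hx : x ∈ feasible α E E') (hy : y ∈ feasible α E E')
    (hxm : IsMaxOn (weightedThroughput θ₁ θ₂) (feasible α E E') x)
    (hym : IsMaxOn (weightedThroughput θ₁ θ₂) (feasible α E E') y) :
    x.P = y.P ∧ x.P' = y.P' := by
  have half : (0 : ℝ) < 1 / 2 := by norm_num
  have hsum : (1 / 2 : ℝ) + 1 / 2 = 1 := by norm_num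
  -- If the powers differed, the midpoint would be strictly better.
  have e := hxm (mix_mem_feasible half.le half.le hsum hx hy)
  have e1 := hxm hy
  have e2 := hym hx
  simp only [Set.mem_ofPred_eq, weightedThroughput_eq, mix] at e e1 e2
  have c1 := add_throughput_le half.le half.le hsum hx.2.1 hy.2.1
  have c2 := add_throughput_le half.le half.le hsum hx.2.2.1 hy.2.2.1
  constructor
  · by_contra hne
    have c := mul_lt_mul_of_pos_left (add_throughput_lt half half hsum hx.2.1 hy.2.1 hne) h₁
    have c' := mul_le_mul_of_nonneg_left c2 h₂.le
    linarith
  · by_contra hne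
    have c := mul_lt_mul_of_pos_left (add_throughput_lt half half hsum hx.2.2.1 hy.2.2.1 hne) h₂
    have c' := mul_le_mul_of_nonneg_left c1 h₁.le
    linarith

/-- A maximal rate pair maximizes some weighted throughput with nonnegative weights. -/
theorem exists_weights {R : ℝ × ℝ} (hR : Maximal (fun S => S ∈ capacityRegion α E E') R) :
    ∃ θ₁ θ₂ : ℝ, 0 ≤ θ₁ ∧ 0 ≤ θ₂ ∧ 0 < θ₁ + θ₂ ∧ ∀ y ∈ feasible α E E',
      θ₁ * throughput y.P + θ₂ * throughput y.P' ≤ θ₁ * R.1 + θ₂ * R.2 := by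
  let U : Set (ℝ × ℝ) := Set.Ioi R.1 ×ˢ Set.Ioi R.2
  -- Dropping nonnegativity makes `D` closed downward, which gives the signs of the weights even
  -- when a coordinate of `R` is zero.
  let D : Set (ℝ × ℝ) :=
    {S | ∃ y ∈ feasible α E E', S.1 ≤ throughput y.P ∧ S.2 ≤ throughput y.P'}
  obtain ⟨x, hx, -, -, hx1, hx2⟩ := mem_capacityRegion.1 hR.1
  have hD : Convex ℝ D := by
    rintro S ⟨y, hy, hy1, hy2⟩ S' ⟨z, hz, hz1, hz2⟩ a b ha hb hab
    refine ⟨mix a b y z, mix_mem_feasible ha hb hab hy hz, ?_, ?_⟩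
    · refine le_trans ?_ (add_throughput_le ha hb hab hy.2.1 hz.2.1)
      exact add_le_add (mul_le_mul_of_nonneg_left hy1 ha) (mul_le_mul_of_nonneg_left hz1 hb)
    · refine le_trans ?_ (add_throughput_le ha hb hab hy.2.2.1 hz.2.2.1)
      exact add_le_add (mul_le_mul_of_nonneg_left hy2 ha) (mul_le_mul_of_nonneg_left hz2 hb)
  have hdisj : Disjoint U D := by
    refine Set.disjoint_left.2 fun S hS ⟨y, hy, hy1, hy2⟩ => ?_
    have l1 : R.1 < throughput y.P := lt_of_lt_of_le hS.1 hy1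
    have l2 : R.2 < throughput y.P' := lt_of_lt_of_le hS.2 hy2
    have := hR.2 (rates_mem_capacityRegion hy) ⟨l1.le, l2.le⟩
    exact l1.not_ge this.1
  obtain ⟨f, u, hfU, hfD⟩ := geometric_hahn_banach_open
    ((convex_Ioi R.1).prod (convex_Ioi R.2)) (isOpen_Ioi.prod isOpen_Ioi) hD hdisj
  have hf : ∀ S : ℝ × ℝ, f S = S.1 * f (1, 0) + S.2 * f (0, 1) := fun S => by
    have : S = S.1 • ((1, 0) : ℝ × ℝ) + S.2 • ((0, 1) : ℝ × ℝ) := by ext <;> simp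
    conv_lhs => rw [this]
    simp only [map_add, map_smul, smul_eq_mul]
  set c₁ := f (1, 0)
  set c₂ := f (0, 1)
  have hU : ∀ ε > 0, R.1 * c₁ + R.2 * c₂ + ε * (c₁ + c₂) < u := fun ε hε => by
    have := hfU (R.1 + ε, R.2 + ε) ⟨by simpa using hε, by simpa using hε⟩
    rw [hf] at this
    simp only at this
    linarith
  have hD1 : ∀ s t, s ≤ R.1 → t ≤ R.2 → u ≤ s * c₁ + t * c₂ := fun s t hs ht => by
    have := hfD (s, t) ⟨x, hx, hs.trans hx1, ht.trans hx2⟩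
    rwa [hf] at this
  have hsum : c₁ + c₂ < 0 := by
    have := hU 1 one_pos
    have := hD1 R.1 R.2 le_rfl le_rfl
    linarith
  have hRu : R.1 * c₁ + R.2 * c₂ ≤ u := by
    by_contra! hlt
    -- At this `ε` the left side of `hU` equals `u`.
    have h := hU ((u - (R.1 * c₁ + R.2 * c₂)) / (c₁ + c₂))
      (div_pos_of_neg_of_neg (by linarith) hsum)
    rw [div_mul_cancel₀ _ hsum.ne] at h
    linarith
  refine ⟨-c₁, -c₂, ?_, ?_, by linarith, fun y hy => ?_⟩
  · have := hD1 (R.1 - 1) R.2 (by linarith) le_rfl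
    linarith
  · have := hD1 R.1 (R.2 - 1) le_rfl (by linarith)
    linarith
  · have := hfD (rates y) ⟨y, hy, le_rfl, le_rfl⟩
    rw [hf] at this
    simp only [rates] at this
    linarith

/-! ### The end points of the boundary -/

theorem row_eq_of_residual {m : Meters T} {a b : Vessel T}
    (h : ReflTransGen (Residual (OpenTap 0) m) a b) : b.1 = a.1 := by
  induction h with
  | refl => rfl
  | tail _ h ih =>
    rw [← ih]
    rcases h with (h | ⟨-, h⟩) | ⟨h | ⟨-, h⟩, -⟩
    · exact h.1.symm
    · omega
    · exact h.1
    · omega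

/-- If the weight of user 1 is large, then no transfer of energy is optimal. -/
theorem IsOptimal.open_all (hα : 0 < α) (h₁ : 0 < θ₁) (h₂ : 0 < θ₂)
    (hθ : α * θ₂ * (∑ v, fill v + 1) ≤ θ₁) {m : Meters T}
    (h : IsOptimal α θ₁ θ₂ fill (OpenTap 0) m) : IsOptimal α θ₁ θ₂ fill (OpenTap T) m := by
  obtain ⟨q, hq, hqr⟩ := (h.balanced hα h₁ h₂).exists_isPrice hα h₁ h₂ h.1
  refine IsPrice.isOptimal hα h₁ h₂ (q := q) ⟨hq.le, hq.eq, fun u v huv => ?_, hq.eq_of_pos⟩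
    (h.1.mono fun a b hab => hab.imp_right fun h => ⟨h.1, by omega⟩)
  rcases huv with huv | ⟨⟨hu, hv, -⟩, -⟩
  · exact hq.anti u v (.inl huv)
  -- The price at `v` is a marginal utility of user 2, at most `α θ₂`; that of user 1 is at least
  -- `θ₁` over the total water plus one.
  obtain ⟨b, hvb, hqv⟩ := hqr v
  have hb : b.1 = 1 := (row_eq_of_residual hvb).trans hv
  have hwb := h.1.water_nonneg b
  have hwu := h.1.water_nonneg u
  have hle := h.1.water_le u
  calc q v = θ₂ / (water fill m b + 1 / α) := by
        rw [hqv, level, if_neg (by simp [hb]), one_div_div]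
    _ ≤ θ₂ / (1 / α) := by gcongr; linarith
    _ = α * θ₂ := by field_simp
    _ ≤ θ₁ / (water fill m u + 1) := by
        rw [le_div_iff₀ (by positivity)]
        refine le_trans ?_ hθ
        gcongr
    _ = 1 / level α θ₁ θ₂ u (water fill m u) := by rw [level, if_pos hu, one_div_div]
    _ ≤ q u := hq.le u

/-- If the weight of user 1 is large, then every optimal policy has the highest throughput of
user 1. -/
theorem throughput_le_of_large_weight (hα : 0 < α) (hE : ∀ i, 0 ≤ E i) (hE' : ∀ i, 0 ≤ E' i)
    (h₁ : 0 < θ₁) (h₂ : 0 < θ₂) (hθ : α * θ₂ * (∑ v, initialWater α E E' v + 1) ≤ θ₁)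
    {x y : Policy T} (hx : x ∈ feasible α E E')
    (hxm : IsMaxOn (weightedThroughput θ₁ θ₂) (feasible α E E') x) (hy : y ∈ feasible α E E') :
    throughput y.P ≤ throughput x.P := by
  obtain ⟨t, ht⟩ := exists_isOptimal (tap := OpenTap 0) (θ₁ := θ₁) (θ₂ := θ₂) hα
    (initialWater_nonneg hα hE hE') fun a b => OpenTap.potential
  have htT := ht.open_all hα h₁ h₂ hθ
  have htF := ht.1.policyOf_mem_feasible hα
  have htm := htT.isMaxOn hα h₁ h₂
  have hδ : ∀ i, (policyOf α (initialWater α E E') t).δ i = 0 := fun i =>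
    ht.1.off _ _ (by
      rintro (⟨h, -⟩ | ⟨-, h⟩)
      · exact absurd h (by simp)
      · simp only at h; omega)
  rw [(power_eq_of_isMaxOn h₁ h₂ hx htF hxm htm).1]
  -- Since `t` transfers nothing, user 1's powers can be exchanged for those of `y` without
  -- affecting user 2.
  let z : Policy T := ⟨(policyOf α (initialWater α E E') t).δ, y.P,
    (policyOf α (initialWater α E E') t).P'⟩
  have hz : z ∈ feasible α E E' := by
    refine ⟨htF.1, hy.2.1, htF.2.2.1, fun k => (hy.2.2.2.1 k).trans ?_, htF.2.2.2.2⟩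
    refine sum_le_sum fun i _ => ?_
    have := hy.1 i
    have := hδ i
    simp only [z]
    linarith
  have h := htm hz
  simp only [Set.mem_ofPred_eq, weightedThroughput_eq, z] at h
  exact le_of_mul_le_mul_left (by linarith) h₁

/-- If the weight of user 2 is large, then user 1 gets no throughput. -/
theorem IsOutput.throughput_eq_zero (hα : 0 < α) (hE : ∀ i, 0 ≤ E i) (hE' : ∀ i, 0 ≤ E' i)
    (h₁ : 0 < θ₁) (h₂ : 0 < θ₂) (hθ : θ₁ * (∑ v, initialWater α E E' v + 1 / α) ≤ θ₂)
    {x : Policy T} (hx : IsOutput α θ₁ θ₂ E E' x) : throughput x.P = 0 := by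
  obtain ⟨m, hm, rfl⟩ := hx
  obtain ⟨hadm, hbal⟩ := hm.admissible_balanced (initialWater_nonneg hα hE hE')
  refine sum_eq_zero fun i _ => ?_
  suffices h : water (initialWater α E E') m (0, i) = 0 by simp [policyOf, h]
  by_contra hne
  have hpos := (hadm.water_nonneg (0, i)).lt_of_ne' hne
  -- Water of user 1 has level above `1 / θ₁`, while the weight of user 2 keeps the vessel below at
  -- or under `1 / θ₁`.
  have hlev := hbal.level_le (a := (0, i)) (b := (1, i))
    (.single (.inl (.inr ⟨⟨rfl, rfl, rfl⟩, Nat.le_add_left _ _⟩))) hpos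
  simp only [level, if_true, one_ne_zero, if_false] at hlev
  have hle := hadm.water_le (1, i)
  rw [div_le_div_iff₀ h₁ h₂] at hlev
  have k1 : (water (initialWater α E E') m (1, i) + 1 / α) * θ₁ ≤ θ₂ := by
    refine le_trans ?_ hθ
    rw [mul_comm]
    gcongr
  nlinarith [mul_pos hpos h₂]

/-- Every maximal rate pair is attained by the algorithm. -/
theorem exists_isOutput_of_maximal (hα : 0 < α) (hE : ∀ i, 0 ≤ E i) (hE' : ∀ i, 0 ≤ E' i)
    {R : ℝ × ℝ} (hR : Maximal (fun S => S ∈ capacityRegion α E E') R) :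
    ∃ θ₁ θ₂ : ℝ, 0 < θ₁ ∧ 0 < θ₂ ∧ ∃ x, IsOutput α θ₁ θ₂ E E' x ∧ R = rates x := by
  obtain ⟨x, hx, hR1, hR2, hx1, hx2⟩ := mem_capacityRegion.1 hR.1
  have hRx : R = rates x := hR.eq_of_le (rates_mem_capacityRegion hx) ⟨hx1, hx2⟩
  obtain ⟨θ₁, θ₂, h₁, h₂, h₁₂, hsup⟩ := exists_weights hR
  have hW : 0 ≤ ∑ v, initialWater α E E' v := sum_nonneg fun v _ => initialWater_nonneg hα hE hE' v
  rcases h₁.eq_or_lt with rfl | h₁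
  -- Weight zero for user 1: the output for lopsided weights has first rate zero and is dominated by
  -- `R`, so its maximality forces equality.
  · have hW' : 0 < ∑ v, initialWater α E E' v + 1 / α := by positivity
    obtain ⟨y, hy⟩ := exists_isOutput hα hE hE' one_pos hW'
    refine ⟨1, _, one_pos, hW', y, hy, ?_⟩
    have hyF := hy.mem_feasible hα hE hE'
    have e1 := hy.throughput_eq_zero hα hE hE' one_pos hW' (by rw [one_mul])
    have e2 := hsup y hyF
    refine (maximal_rates one_pos hW' hyF (hy.isMaxOn hα hE hE' one_pos hW')).eq_of_ge hR.1
      ⟨?_, ?_⟩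
    · simpa only [rates, e1] using hR1
    · simp only [zero_mul, zero_add] at e2 h₁₂
      exact le_of_mul_le_mul_left e2 h₁₂
  rcases h₂.eq_or_lt with rfl | h₂
  -- Weight zero for user 2: the output attains the highest first rate, and its weighted optimality
  -- then bounds the second rate of `R`.
  · have hW' : 0 < α * 1 * (∑ v, initialWater α E E' v + 1) := by positivity
    obtain ⟨y, hy⟩ := exists_isOutput hα hE hE' hW' one_pos
    refine ⟨_, 1, hW', one_pos, y, hy, ?_⟩
    have hyF := hy.mem_feasible hα hE hE'
    have hym := hy.isMaxOn hα hE hE' hW' one_pos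
    have e1 := throughput_le_of_large_weight hα hE hE' hW' one_pos le_rfl hyF hym hx
    have e2 := hsup y hyF
    simp only [zero_mul, add_zero] at e2
    have e3 := le_of_mul_le_mul_left e2 h₁
    have e4 := weighted_le_of_isMaxOn hW' one_pos hym hR.1
    refine hR.eq_of_le (rates_mem_capacityRegion hyF) ⟨hx1.trans e1, ?_⟩
    have e5 := mul_le_mul_of_nonneg_left e3 hW'.le
    simp only [rates] at e4 ⊢
    linarith
  · obtain ⟨y, hy⟩ := exists_isOutput hα hE hE' h₁ h₂
    refine ⟨θ₁, θ₂, h₁, h₂, y, hy, ?_⟩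
    have hxm : IsMaxOn (weightedThroughput θ₁ θ₂) (feasible α E E') x := fun z hz => by
      have := hsup z hz
      rw [hRx] at this
      simpa only [Set.mem_ofPred_eq, weightedThroughput_eq, rates] using this
    obtain ⟨hP, hP'⟩ := power_eq_of_isMaxOn h₁ h₂ hx (hy.mem_feasible hα hE hE') hxm
      (hy.isMaxOn hα hE hE' h₁ h₂)
    rw [hRx, rates, rates, hP, hP']

end TwoWay

theorem mainTheorem1 {T : ℕ} (α : ℝ) (hα₀ : 0 < α) (hα₁ : α ≤ 1) (E E' : Fin T → ℝ)
    (hE : ∀ i, 0 ≤ E i) (hE' : ∀ i, 0 ≤ E' i) :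
    (∀ θ₁ θ₂ : ℝ, 0 < θ₁ → 0 < θ₂ →
      (∃ x, TwoWay.IsOutput α θ₁ θ₂ E E' x) ∧
      ∀ x, TwoWay.IsOutput α θ₁ θ₂ E E' x →
        x ∈ TwoWay.feasible α E E' ∧
        IsMaxOn (TwoWay.weightedThroughput θ₁ θ₂) (TwoWay.feasible α E E') x ∧
        TwoWay.rates x ∈ frontier (TwoWay.capacityRegion α E E')) ∧
    {R : ℝ × ℝ | ∃ θ₁ θ₂ : ℝ, 0 < θ₁ ∧ 0 < θ₂ ∧
        ∃ x, TwoWay.IsOutput α θ₁ θ₂ E E' x ∧ R = TwoWay.rates x} =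
      {R : ℝ × ℝ | Maximal (fun S => S ∈ TwoWay.capacityRegion α E E') R} := by
  refine ⟨fun θ₁ θ₂ h₁ h₂ => ⟨TwoWay.exists_isOutput hα₀ hE hE' h₁ h₂, fun x hx => ?_⟩, ?_⟩
  · have hF := hx.mem_feasible hα₀ hE hE'
    have hm := hx.isMaxOn hα₀ hE hE' h₁ h₂
    exact ⟨hF, hm, TwoWay.rates_mem_frontier h₁ h₂ hF hm⟩
  · refine Set.Subset.antisymm ?_ fun R hR => TwoWay.exists_isOutput_of_maximal hα₀ hE hE' hR
    rintro R ⟨θ₁, θ₂, h₁, h₂, x, hx, rfl⟩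
    exact TwoWay.maximal_rates h₁ h₂ (hx.mem_feasible hα₀ hE hE') (hx.isMaxOn hα₀ hE hE' h₁ h₂)
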